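/- Let $L\ge 1$ be a fixed integer and, for each integer $N\ge 1$, let $M=M(N)\ge 1$ be an integer such that $c_N=\frac{M(N)L}{N}\to c_*$ as $N\to+\infty$, for some $c_*>0$. Let $0<a<b$ be constants and, for each $N\geq 1$, let $R_N$ be an $M\times M$ Hermitian matrix with $aI_M\le R_N<bI_M$. Put $\mathbb C^+=\{z:\operatorname{Im}z>0\}$ and $\mathbb R^+=[0,+\infty)$. 1. For every $N\ge 1$ and $z\in\mathbb C^+$ the equation $$t=\frac1M\operatorname{Tr}\,R_N\Big(-zI_M-\frac{zc_Nt}{1-zc_N^2t^2}R_N\Big)^{-1}$$ has a unique solution $t=t_N(z)$ with $t\in\mathbb C^+$ and $zt\in\mathbb C^+$. For this solution $1-zc_N^2t_N(z)^2\neq 0$ and the matrix being inverted is invertible. 2. For every $N\ge1$, $z\mapsto t_N(z)$ is the Stieltjes transform of a positive finite measure $\mu_N$ carried by $\mathbb R^+$, that is, $t_N(z)=\int_{\mathbb R^+}\frac{d\mu_N(\lambda)}{\lambda-z}$ for $z\in\mathbb C^+$, and $$\mu_N(\mathbb R^+)=\frac1M\operatorname{Tr}R_N,\qquad \int_{\mathbb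 R^+}\lambda\,d\mu_N(\lambda)=c_N\,\frac1M\operatorname{Tr}R_N\,\frac1M\operatorname{Tr}R_N^2 .$$ 3. There are constants $\beta,\kappa>0$, independent of $N$ and $z$, such that for all $N\ge1$ and $z\in\mathbb C^+$ $$\frac1{|1-z(c_Nt_N(z))^2|}\le\frac{\kappa(\beta^2+|z|^2)^2}{(\operatorname{Im}z)^3}.$$ 4. For every $N\ge1$, the matrix-valued function $$T_N(z)=-\Big(zI_M+\frac{zc_Nt_N(z)}{1-zc_N^2t_N(z)^2}R_N\Big)^{-1}$$ is the Stieltjes transform on $\mathbb C^+$ of a positive (Hermitian positive semidefinite) $M\times M$ matrix-valued finite measure $\nu_N^T$ carried by $\mathbb R^+$, with $\nu_N^T(\mathbb R^+)=I_M$ and $\mu_N=\frac1M\operatorname{Tr}R_N\nu_N^T$. -/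

import Mathlib

open MeasureTheory Filter Topology
open scoped ComplexOrder

/-- `f` is, on the upper half-plane, the Stieltjes transform `∫ dμ(x) / (x - z)` of the positive
finite measure `μ` carried by the Borel set `A`. -/
def IsStieltjesTransform (A : Set ℝ) (μ : Measure ℝ) (f : ℂ → ℂ) : Prop :=
  IsFiniteMeasure μ ∧ μ Aᶜ = 0 ∧
    ∀ z : ℂ, 0 < z.im → f z = ∫ x : ℝ, ((x : ℂ) - z)⁻¹ ∂μ

/-- The complex measure `S ↦ (ν S) i j`, the `(i, j)` entry of a matrix-valued measure `ν`. -/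
noncomputable def entryMeasure {m : ℕ} (ν : VectorMeasure ℝ (Matrix (Fin m) (Fin m) ℂ))
    (i j : Fin m) : ComplexMeasure ℝ :=
  ν.mapRange (Matrix.entryAddMonoidHom ℂ i j) (continuous_id.matrix_elem i j)

theorem entryMeasure_apply {m : ℕ} (ν : VectorMeasure ℝ (Matrix (Fin m) (Fin m) ℂ))
    (i j : Fin m) (S : Set ℝ) : entryMeasure ν i j S = ν S i j := rfl

/-- `F` is, on the upper half-plane, the Stieltjes transform `∫ dν(x) / (x - z)` (entry by entry)
of the positive (i.e. with positive semidefinite Hermitian values) finite matrix-valued measure `ν`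
carried by the Borel set `A`. A `VectorMeasure` is σ-additive with values in matrices, so finiteness
is built in. -/
def IsMatrixStieltjesTransform {m : ℕ} (A : Set ℝ)
    (ν : VectorMeasure ℝ (Matrix (Fin m) (Fin m) ℂ))
    (F : ℂ → Matrix (Fin m) (Fin m) ℂ) : Prop :=
  (∀ S : Set ℝ, MeasurableSet S → (ν S).PosSemidef) ∧ ν Aᶜ = 0 ∧
    ∀ z : ℂ, 0 < z.im → ∀ i j : Fin m,
      F z i j =
        (entryMeasure ν i j).integral (fun x : ℝ => ((x : ℂ) - z)⁻¹) (ContinuousLinearMap.mul ℝ ℂ)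

/-- The scalar `z c t / (1 - z c² t²)`. -/
noncomputable def couplingCoeff (c : ℝ) (z t : ℂ) : ℂ :=
  z * c * t / (1 - z * (c : ℂ) ^ 2 * t ^ 2)

/-- `t` solves `t = (1/m) Tr R (-z I - (z c t / (1 - z c² t²)) R)⁻¹`, with `t` and `z t` in the
open upper half-plane. -/
def IsCanonicalSolution {m : ℕ} (c : ℝ) (R : Matrix (Fin m) (Fin m) ℂ) (z t : ℂ) : Prop :=
  t = (1 / (m : ℂ)) *
      (R * (-(z • (1 : Matrix (Fin m) (Fin m) ℂ)) - couplingCoeff c z t • R)⁻¹).trace ∧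
    0 < t.im ∧ 0 < (z * t).im

/-- The matrix `T = -(z I + (z c t / (1 - z c² t²)) R)⁻¹`. -/
noncomputable def canonicalT {m : ℕ} (c : ℝ) (R : Matrix (Fin m) (Fin m) ℂ) (z t : ℂ) :
    Matrix (Fin m) (Fin m) ℂ :=
  -(z • (1 : Matrix (Fin m) (Fin m) ℂ) + couplingCoeff c z t • R)⁻¹

/-- The ratio `c_N = M(N) L / N`. -/
noncomputable def dimRatio (L : ℕ) (M : ℕ → ℕ) (N : ℕ) : ℝ :=
  (M N : ℝ) * (L : ℝ) / (N : ℝ)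

/-! Put `z = u²` with `u` in the open first quadrant and `h = u t`. After unitary diagonalization of
`R_N` the trace equation becomes a scalar fixed-point equation `h = Φ(h)`, with `Φ = resolventMap` a
self-map of the upper half-plane.

`Φ` is a strict contraction in disguise. With `q = contractionFactor`, one has `Im Φ(h) = Im u ·
Γ(h) + q(h) Im h` with `Γ > 0` (`resolventMap_im`), and `‖Φ(h) - Φ(k)‖² ≤ q(h) q(k) ‖h - k‖²`
(`norm_resolventMap_sub_sq_le`). At a fixed point the identity forces `q < 1`, hence uniqueness. On
an invariant region `q(h) Im h ≤ ρ Im Φ(h)` with `ρ < 1`, so iterates converge.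

The iterates are Stieltjes transforms of finitely many atoms, because one application of the
recursion is a diagonal entry of the resolvent of an explicit real symmetric matrix
(`exists_atoms_dressedResolvent`). They are odd in `u`, so their atoms can be squared, which gives
probability measures on `[0, ∞)` in the variable `z`, with a mean independent of the iteration.
Tightness provides limit measures `νᵢ`, one per eigenvalue (`exists_measures_of_resolventMap`);
their means are read off from the behaviour at infinity. Then `ν_N^T = U diag(νᵢ) Uᴴ`, and `μ_N` is
the sum of the `νᵢ` weighted by `lᵢ / M`.

For the uniform bound, `Im u ‖h‖ ≤ τ ‖1 - c² h²‖`, where `τ` is the normalized trace of `R_N`,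
bounds the denominator below by a multiple of `‖t‖`, and the bounded means keep mass near the
origin, so `‖t‖ ≥ Im t` is not too small. -/

/-! ### The fixed-point map on the upper half-plane: contraction and uniqueness. -/

/-- The function `h ↦ c h / (1 - c² h²)`. -/
noncomputable def selfEnergy (c : ℝ) (h : ℂ) : ℂ := c * h / (1 - (c : ℂ) ^ 2 * h ^ 2)

/-- The function `-1 / (u + r c h / (1 - c² h²))`. -/
noncomputable def dressedResolvent (c r : ℝ) (u h : ℂ) : ℂ := -(u + r * selfEnergy c h)⁻¹

/-- The map `h ↦ ∑ aᵢ (-1 / (u + rᵢ c h / (1 - c² h²)))`. -/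
noncomputable def resolventMap {ι : Type*} [Fintype ι] (a r : ι → ℝ) (c : ℝ) (u h : ℂ) : ℂ :=
  ∑ i, (a i : ℂ) * dressedResolvent c (r i) u h

/-- The factor by which `resolventMap` contracts the hyperbolic distance, up to normalisation. -/
noncomputable def contractionFactor {ι : Type*} [Fintype ι] (a r : ι → ℝ) (c : ℝ) (u h : ℂ) : ℝ :=
  (∑ i, a i * r i * ‖dressedResolvent c (r i) u h‖ ^ 2) *
    (c * (1 + c ^ 2 * ‖h‖ ^ 2) / ‖1 - (c : ℂ) ^ 2 * h ^ 2‖ ^ 2)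

/-- The factors `1 - c h` and `1 + c h` have nonzero imaginary parts. -/
theorem one_sub_sq_ne_zero {c : ℝ} (hc : 0 < c) {h : ℂ} (hh : 0 < h.im) :
    1 - (c : ℂ) ^ 2 * h ^ 2 ≠ 0 := by
  intro H
  have h1 : (1 - c * h) * (1 + c * h) = 0 := by linear_combination H
  rcases mul_eq_zero.1 h1 with h2 | h2 <;>
  · have := congrArg Complex.im h2
    simp at this
    rcases this with h3 | h3 <;> linarith

theorem selfEnergy_im (c : ℝ) (h : ℂ) :
    (selfEnergy c h).im =
      c * (1 + c ^ 2 * ‖h‖ ^ 2) / ‖1 - (c : ℂ) ^ 2 * h ^ 2‖ ^ 2 * h.im := by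
  rw [selfEnergy, Complex.div_im, Complex.sq_norm, Complex.sq_norm]
  have h1 : ((c : ℂ) * h).im = c * h.im := by simp
  have h2 : ((c : ℂ) * h).re = c * h.re := by simp
  have h3 : (1 - (c : ℂ) ^ 2 * h ^ 2).re = 1 - c ^ 2 * (h.re ^ 2 - h.im ^ 2) := by
    simp [pow_two]
  have h4 : (1 - (c : ℂ) ^ 2 * h ^ 2).im = - (c ^ 2 * (2 * h.re * h.im)) := by
    rw [pow_two, pow_two]; simp; ring
  rw [h1, h2, h3, h4, Complex.normSq_apply h]
  ring

theorem selfEnergy_im_pos {c : ℝ} (hc : 0 < c) {h : ℂ} (hh : 0 < h.im) :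
    0 < (selfEnergy c h).im := by
  rw [selfEnergy_im]
  have := norm_pos_iff.2 (one_sub_sq_ne_zero hc hh)
  positivity

theorem add_mul_ne_zero_of_im {r : ℝ} (hr : 0 ≤ r) {u w : ℂ} (hu : 0 < u.im) (hw : 0 ≤ w.im) :
    u + r * w ≠ 0 := by
  intro H
  have := congrArg Complex.im H
  simp at this
  nlinarith [mul_nonneg hr hw]

theorem neg_inv_im (x : ℂ) : (-x⁻¹).im = ‖x⁻¹‖ ^ 2 * x.im := by
  rw [Complex.neg_im, Complex.inv_im, norm_inv, inv_pow, Complex.sq_norm]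
  ring

theorem dressedResolvent_im (c r : ℝ) (u h : ℂ) :
    (dressedResolvent c r u h).im =
      ‖dressedResolvent c r u h‖ ^ 2 * (u.im + r * (selfEnergy c h).im) := by
  rw [dressedResolvent, neg_inv_im, norm_neg]
  simp

section

variable {ι : Type*} [Fintype ι] {a r : ι → ℝ} {c : ℝ} {u : ℂ}

/-- The coefficient of `Im h` is the same factor that controls differences of `resolventMap`; this
coincidence drives both uniqueness and convergence. -/
theorem resolventMap_im (a r : ι → ℝ) (c : ℝ) (u h : ℂ) :
    (resolventMap a r c u h).im =
      u.im * (∑ i, a i * ‖dressedResolvent c (r i) u h‖ ^ 2) +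
        contractionFactor a r c u h * h.im := by
  have : (contractionFactor a r c u h) * h.im =
      (∑ i, a i * r i * ‖dressedResolvent c (r i) u h‖ ^ 2) * (selfEnergy c h).im := by
    rw [contractionFactor, selfEnergy_im]; ring
  rw [this, resolventMap, Complex.im_sum, Finset.mul_sum, Finset.sum_mul,
    ← Finset.sum_add_distrib]
  refine Finset.sum_congr rfl fun i _ => ?_
  rw [Complex.im_ofReal_mul, dressedResolvent_im]
  ring

theorem contractionFactor_nonneg (ha : ∀ i, 0 < a i) (hr : ∀ i, 0 < r i) (hc : 0 < c) (u h : ℂ) :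
    0 ≤ contractionFactor a r c u h := by
  unfold contractionFactor
  have : 0 ≤ ∑ i, a i * r i * ‖dressedResolvent c (r i) u h‖ ^ 2 :=
    Finset.sum_nonneg fun i _ => by have := ha i; have := hr i; positivity
  positivity

theorem dressedResolvent_ne_zero {s : ℝ} (hs : 0 ≤ s) (hc : 0 < c) (hu : 0 < u.im) {h : ℂ}
    (hh : 0 < h.im) : dressedResolvent c s u h ≠ 0 :=
  neg_ne_zero.2 (inv_ne_zero (add_mul_ne_zero_of_im hs hu (selfEnergy_im_pos hc hh).le))

theorem weighted_norm_sq_pos [Nonempty ι] (ha : ∀ i, 0 < a i) (hr : ∀ i, 0 < r i) (hc : 0 < c)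
    (hu : 0 < u.im) {h : ℂ} (hh : 0 < h.im) :
    0 < ∑ i, a i * ‖dressedResolvent c (r i) u h‖ ^ 2 :=
  Finset.sum_pos (fun i _ => mul_pos (ha i)
    (pow_pos (norm_pos_iff.2 (dressedResolvent_ne_zero (hr i).le hc hu hh)) 2))
    Finset.univ_nonempty

theorem resolventMap_im_pos [Nonempty ι] (ha : ∀ i, 0 < a i) (hr : ∀ i, 0 < r i) (hc : 0 < c)
    (hu : 0 < u.im) {h : ℂ} (hh : 0 < h.im) : 0 < (resolventMap a r c u h).im := by
  rw [resolventMap_im]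
  have h1 := weighted_norm_sq_pos ha hr hc hu hh
  have h2 := contractionFactor_nonneg ha hr hc u h
  positivity

/-- Cauchy–Schwarz gives `‖Φ h‖² Im u ≤ (∑ aᵢ) Im (Φ h)`. -/
theorem norm_sq_resolventMap_le (ha : ∀ i, 0 < a i) (hr : ∀ i, 0 < r i) (hc : 0 < c)
    (hu : 0 < u.im) {h : ℂ} (hh : 0 ≤ h.im) :
    u.im * ‖resolventMap a r c u h‖ ^ 2 ≤ (∑ i, a i) * (resolventMap a r c u h).im := by
  have h1 : ‖resolventMap a r c u h‖ ^ 2 ≤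
      (∑ i, a i) * ∑ i, a i * ‖dressedResolvent c (r i) u h‖ ^ 2 := by
    calc _ ≤ (∑ i, a i * ‖dressedResolvent c (r i) u h‖) ^ 2 := by
          refine pow_le_pow_left₀ (norm_nonneg _) ?_ 2
          refine (norm_sum_le _ _).trans (Finset.sum_le_sum fun i _ => ?_)
          rw [norm_mul, Complex.norm_real, Real.norm_of_nonneg (ha i).le]
      _ ≤ _ := by
          refine Finset.sum_sq_le_sum_mul_sum_of_sq_le_mul _ (fun i _ => (ha i).le)
            (fun i _ => mul_nonneg (ha i).le (sq_nonneg _)) fun i _ => le_of_eq (by ring)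
  have h2 := contractionFactor_nonneg ha hr hc u h
  have h3 : 0 ≤ ∑ i, a i := Finset.sum_nonneg fun i _ => (ha i).le
  rw [resolventMap_im]
  have h4 := mul_le_mul_of_nonneg_left h1 hu.le
  have h5 : 0 ≤ (∑ i, a i) * (contractionFactor a r c u h * h.im) := by positivity
  linarith

/-- A two-point Schwarz–Pick estimate. The resolvent identity factors the difference into mixed
terms in `h` and `k`; Cauchy–Schwarz, applied to the sum and to `1 + c² h k`, separates them into a
product of one-point factors. -/
theorem norm_resolventMap_sub_sq_le (ha : ∀ i, 0 < a i) (hr : ∀ i, 0 < r i) (hc : 0 < c)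
    (hu : 0 < u.im) {h k : ℂ} (hh : 0 < h.im) (hk : 0 < k.im) :
    ‖resolventMap a r c u h - resolventMap a r c u k‖ ^ 2 ≤
      ‖h - k‖ ^ 2 * (contractionFactor a r c u h * contractionFactor a r c u k) := by
  have nh := one_sub_sq_ne_zero hc hh
  have nk := one_sub_sq_ne_zero hc hk
  have e1 : resolventMap a r c u h - resolventMap a r c u k =
      (selfEnergy c h - selfEnergy c k) *
        ∑ i, (a i : ℂ) * r i * (dressedResolvent c (r i) u h * dressedResolvent c (r i) u k) := by
    rw [resolventMap, resolventMap, ← Finset.sum_sub_distrib, Finset.mul_sum]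
    refine Finset.sum_congr rfl fun i _ => ?_
    have n1 := add_mul_ne_zero_of_im (hr i).le hu (selfEnergy_im_pos hc hh).le
    have n2 := add_mul_ne_zero_of_im (hr i).le hu (selfEnergy_im_pos hc hk).le
    unfold dressedResolvent
    field_simp
    ring
  have e2 : selfEnergy c h - selfEnergy c k = (h - k) * (c * (1 + (c : ℂ) ^ 2 * (h * k)) /
      ((1 - (c : ℂ) ^ 2 * h ^ 2) * (1 - (c : ℂ) ^ 2 * k ^ 2))) := by
    unfold selfEnergy
    field_simp
    ring
  have i1 : ‖∑ i, (a i : ℂ) * r i *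
      (dressedResolvent c (r i) u h * dressedResolvent c (r i) u k)‖ ^ 2 ≤
      (∑ i, a i * r i * ‖dressedResolvent c (r i) u h‖ ^ 2) *
      (∑ i, a i * r i * ‖dressedResolvent c (r i) u k‖ ^ 2) := by
    calc _ ≤ (∑ i, a i * r i *
          (‖dressedResolvent c (r i) u h‖ * ‖dressedResolvent c (r i) u k‖)) ^ 2 := by
          refine pow_le_pow_left₀ (norm_nonneg _) ?_ 2
          refine (norm_sum_le _ _).trans (Finset.sum_le_sum fun i _ => ?_)
          rw [norm_mul, norm_mul, norm_mul, Complex.norm_real, Complex.norm_real,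
            Real.norm_of_nonneg (ha i).le, Real.norm_of_nonneg (hr i).le]
      _ ≤ _ := by
          refine Finset.sum_sq_le_sum_mul_sum_of_sq_le_mul _
            (fun i _ => mul_nonneg (mul_pos (ha i) (hr i)).le (sq_nonneg _))
            (fun i _ => mul_nonneg (mul_pos (ha i) (hr i)).le (sq_nonneg _)) fun i _ => le_of_eq (by ring)
  have i2 : ‖1 + (c : ℂ) ^ 2 * (h * k)‖ ^ 2 ≤
      (1 + c ^ 2 * ‖h‖ ^ 2) * (1 + c ^ 2 * ‖k‖ ^ 2) := by
    have : ‖1 + (c : ℂ) ^ 2 * (h * k)‖ ≤ 1 + c ^ 2 * (‖h‖ * ‖k‖) := by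
      refine (norm_add_le _ _).trans ?_
      simp [abs_of_pos hc]
    refine (pow_le_pow_left₀ (norm_nonneg _) this 2).trans ?_
    nlinarith [sq_nonneg (c * (‖h‖ - ‖k‖))]
  have p1 := norm_pos_iff.2 nh
  have p2 := norm_pos_iff.2 nk
  rw [e1, e2, norm_mul, norm_mul, mul_pow, mul_pow, norm_div, norm_mul, norm_mul, Complex.norm_real,
    Real.norm_of_nonneg hc.le, mul_assoc]
  refine mul_le_mul_of_nonneg_left ?_ (sq_nonneg _)
  unfold contractionFactor
  calc _ ≤ (c ^ 2 * ((1 + c ^ 2 * ‖h‖ ^ 2) * (1 + c ^ 2 * ‖k‖ ^ 2)) /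
        (‖1 - (c : ℂ) ^ 2 * h ^ 2‖ * ‖1 - (c : ℂ) ^ 2 * k ^ 2‖) ^ 2) *
        ((∑ i, a i * r i * ‖dressedResolvent c (r i) u h‖ ^ 2) *
        (∑ i, a i * r i * ‖dressedResolvent c (r i) u k‖ ^ 2)) := by
        rw [div_pow, mul_pow]
        gcongr
    _ = _ := by
        field_simp

/-- At a fixed point `resolventMap_im` reads `(1 - q) Im h = Im u · Γ > 0`. -/
theorem contractionFactor_lt_one_of_fixed [Nonempty ι] (ha : ∀ i, 0 < a i) (hr : ∀ i, 0 < r i)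
    (hc : 0 < c) (hu : 0 < u.im) {h : ℂ} (hh : 0 < h.im) (hfix : resolventMap a r c u h = h) :
    contractionFactor a r c u h < 1 := by
  have h1 := resolventMap_im a r c u h
  rw [hfix] at h1
  have h2 := mul_pos hu (weighted_norm_sq_pos ha hr hc hu hh)
  by_contra! H
  nlinarith

theorem resolventMap_fixed_unique [Nonempty ι] (ha : ∀ i, 0 < a i) (hr : ∀ i, 0 < r i)
    (hc : 0 < c) (hu : 0 < u.im) {h k : ℂ} (hh : 0 < h.im) (hk : 0 < k.im)
    (hfix : resolventMap a r c u h = h) (kfix : resolventMap a r c u k = k) : h = k := by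
  have h1 := norm_resolventMap_sub_sq_le ha hr hc hu hh hk
  have q1 := contractionFactor_lt_one_of_fixed ha hr hc hu hh hfix
  have q2 := contractionFactor_lt_one_of_fixed ha hr hc hu hk kfix
  have n1 := contractionFactor_nonneg ha hr hc u h
  rw [hfix, kfix] at h1
  have q3 := mul_lt_one_of_nonneg_of_lt_one_left n1 q1 q2.le
  have : ‖h - k‖ ^ 2 ≤ 0 := by
    by_contra! H
    nlinarith
  rw [← sub_eq_zero, ← norm_eq_zero]
  exact pow_eq_zero_iff two_ne_zero |>.1 (le_antisymm this (sq_nonneg _))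

/-! ### Existence of the fixed point by iteration. -/

/-- When `Im u ‖h‖² ≤ τ Im h`, the function `c h / (1 - c² h²)` is bounded by `c τ / Im u`. -/
theorem im_mul_norm_le {τ : ℝ} (hτ : 0 < τ) (hc : 0 < c) {h : ℂ} (hh : 0 < h.im)
    (hS : u.im * ‖h‖ ^ 2 ≤ τ * h.im) :
    u.im * ‖h‖ ≤ τ * ‖1 - (c : ℂ) ^ 2 * h ^ 2‖ := by
  have hn : 0 < ‖h‖ := norm_pos_iff.2 (by rintro rfl; simp at hh)
  -- Multiplying `1 - c² h²` by the conjugate of `h` gives imaginary part `-(Im h)(1 + c² ‖h‖²)`.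
  have h1 : h.im ≤ ‖h‖ * ‖1 - (c : ℂ) ^ 2 * h ^ 2‖ := by
    have e : (starRingEnd ℂ h * (1 - (c : ℂ) ^ 2 * h ^ 2)).im =
        - (h.im * (1 + c ^ 2 * ‖h‖ ^ 2)) := by
      rw [Complex.sq_norm, Complex.normSq_apply]
      simp [pow_two]
      ring
    have := Complex.abs_im_le_norm (starRingEnd ℂ h * (1 - (c : ℂ) ^ 2 * h ^ 2))
    rw [e, abs_neg, abs_of_nonneg (by positivity), norm_mul, RCLike.norm_conj] at this
    have : 0 ≤ h.im * (c ^ 2 * ‖h‖ ^ 2) := by positivity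
    linarith
  have := hS.trans (mul_le_mul_of_nonneg_left h1 hτ.le)
  refine le_of_mul_le_mul_left ?_ hn
  linarith

theorem im_mul_norm_selfEnergy_le {τ : ℝ} (hτ : 0 < τ) (hc : 0 < c) {h : ℂ} (hh : 0 < h.im)
    (hS : u.im * ‖h‖ ^ 2 ≤ τ * h.im) : u.im * ‖selfEnergy c h‖ ≤ c * τ := by
  have h1 := im_mul_norm_le hτ hc hh hS
  have nh := norm_pos_iff.2 (one_sub_sq_ne_zero hc hh)
  rw [selfEnergy, norm_div, norm_mul, Complex.norm_real, Real.norm_of_nonneg hc.le, ← mul_div_assoc,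
    div_le_iff₀ nh]
  nlinarith

theorem sum_pos_of_pos [Nonempty ι] (ha : ∀ i, 0 < a i) : 0 < ∑ i, a i :=
  Finset.sum_pos (fun i _ => ha i) Finset.univ_nonempty

/-- The contraction factor, normalised by imaginary parts, is uniformly less than one on the
invariant region `Im u ‖h‖² ≤ (∑ aᵢ) Im h`. -/
theorem exists_contractionFactor_mul_im_le [Nonempty ι] (ha : ∀ i, 0 < a i) (hr : ∀ i, 0 < r i)
    (hc : 0 < c) (hu : 0 < u.im) :
    ∃ ρ : ℝ, 0 ≤ ρ ∧ ρ < 1 ∧ ∀ h : ℂ, 0 < h.im → u.im * ‖h‖ ^ 2 ≤ (∑ i, a i) * h.im →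
      contractionFactor a r c u h * h.im ≤ ρ * (resolventMap a r c u h).im := by
  have hτ := sum_pos_of_pos ha
  set τ := ∑ i, a i
  set b := ∑ i, r i
  have hb : 0 < b := sum_pos_of_pos hr
  have hrb : ∀ i, r i ≤ b := fun i =>
    Finset.single_le_sum (fun j _ => (hr j).le) (Finset.mem_univ i)
  set W := c * τ / u.im
  have hW : 0 < W := by positivity
  -- If `q(h) Im h ≤ b W Γ`, then its ratio to `Im Φ(h) = Im u · Γ + q(h) Im h` is at most `b W /
  -- (Im u + b W)`, since `x / (Im u · Γ + x)` increases with `x`.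
  refine ⟨b * W / (u.im + b * W), by positivity, (div_lt_one (by positivity)).2 (by linarith),
    fun h hh hS => ?_⟩
  set Γ := ∑ i, a i * ‖dressedResolvent c (r i) u h‖ ^ 2
  have hΓ : 0 < Γ := weighted_norm_sq_pos ha hr hc hu hh
  have h1 : contractionFactor a r c u h * h.im ≤ b * W * Γ := by
    have e : contractionFactor a r c u h * h.im =
        (∑ i, a i * r i * ‖dressedResolvent c (r i) u h‖ ^ 2) * (selfEnergy c h).im := by
      rw [contractionFactor, selfEnergy_im]; ring
    have i1 : ∑ i, a i * r i * ‖dressedResolvent c (r i) u h‖ ^ 2 ≤ b * Γ := by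
      rw [Finset.mul_sum]
      refine Finset.sum_le_sum fun i _ => ?_
      have := mul_le_mul_of_nonneg_left (hrb i)
        (mul_nonneg (ha i).le (sq_nonneg ‖dressedResolvent c (r i) u h‖))
      linarith
    have i2 : (selfEnergy c h).im ≤ W := by
      rw [le_div_iff₀ hu]
      have h1 := im_mul_norm_selfEnergy_le hτ hc hh hS
      have h2 := mul_le_mul_of_nonneg_left (Complex.im_le_norm (selfEnergy c h)) hu.le
      linarith
    rw [e]
    calc _ ≤ b * Γ * W := mul_le_mul i1 i2 (selfEnergy_im_pos hc hh).le (by positivity)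
      _ = _ := by ring
  rw [resolventMap_im, div_mul_eq_mul_div, le_div_iff₀ (by positivity)]
  nlinarith

/-- The point `0` is included because it is the only real point in the closed region `Im u ‖h‖² ≤ τ
Im h`, to which a limit of iterates belongs. -/
theorem continuousAt_resolventMap (hc : 0 < c) (hu : 0 < u.im) (hr : ∀ i, 0 < r i) {h : ℂ}
    (hh : 0 < h.im ∨ h = 0) : ContinuousAt (resolventMap a r c u) h := by
  have h1 : 1 - (c : ℂ) ^ 2 * h ^ 2 ≠ 0 := by
    rcases hh with hh | rfl
    · exact one_sub_sq_ne_zero hc hh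
    · simp
  have h2 : 0 ≤ (selfEnergy c h).im := by
    rcases hh with hh | rfl
    · exact (selfEnergy_im_pos hc hh).le
    · simp [selfEnergy]
  have h3 : ContinuousAt (selfEnergy c) h := by
    unfold selfEnergy
    exact ContinuousAt.div (by fun_prop) (by fun_prop) h1
  unfold resolventMap dressedResolvent
  refine tendsto_finsetSum _ fun i _ => ContinuousAt.mul continuousAt_const
    (ContinuousAt.neg (ContinuousAt.inv₀ ?_ (add_mul_ne_zero_of_im (hr i).le hu h2)))
  fun_prop

/-- The iterates of `resolventMap` started at its value at zero. -/
noncomputable def resolventIterate (a r : ι → ℝ) (c : ℝ) (u : ℂ) : ℕ → ℂ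
  | 0 => resolventMap a r c u 0
  | n + 1 => resolventMap a r c u (resolventIterate a r c u n)

theorem resolventMap_zero (a r : ι → ℝ) (c : ℝ) (u : ℂ) :
    resolventMap a r c u 0 = -(∑ i, a i : ℝ) / u := by
  simp [resolventMap, dressedResolvent, selfEnergy, Finset.sum_mul, div_eq_mul_inv]

theorem resolventIterate_mem [Nonempty ι] (ha : ∀ i, 0 < a i) (hr : ∀ i, 0 < r i)
    (hc : 0 < c) (hu : 0 < u.im) (n : ℕ) :
    0 < (resolventIterate a r c u n).im ∧
      u.im * ‖resolventIterate a r c u n‖ ^ 2 ≤ (∑ i, a i) * (resolventIterate a r c u n).im := by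
  induction n with
  | zero =>
    refine ⟨?_, norm_sq_resolventMap_le ha hr hc hu (by simp)⟩
    have h0 : u ≠ 0 := by rintro rfl; simp at hu
    have h1 := Complex.normSq_pos.2 h0
    have hτ := sum_pos_of_pos ha
    rw [resolventIterate, resolventMap_zero, neg_div, Complex.neg_im, Complex.div_im]
    simp only [Complex.ofReal_im, zero_mul, zero_div, zero_sub, neg_neg, Complex.ofReal_re]
    positivity
  | succ n ih =>
    exact ⟨resolventMap_im_pos ha hr hc hu ih.1, norm_sq_resolventMap_le ha hr hc hu ih.1.le⟩

/-- The quantity `‖h - k‖² / (Im h · Im k)` shrinks by a factor `ρ²` at each iteration; the uniform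
bound on imaginary parts turns this into geometric decay of the norms. -/
theorem cauchySeq_resolventIterate [Nonempty ι] (ha : ∀ i, 0 < a i) (hr : ∀ i, 0 < r i)
    (hc : 0 < c) (hu : 0 < u.im) : CauchySeq (resolventIterate a r c u) := by
  obtain ⟨ρ, h0, h1, hρ⟩ := exists_contractionFactor_mul_im_le ha hr hc hu
  have hτ := sum_pos_of_pos ha
  have mem := resolventIterate_mem ha hr hc hu
  set x := resolventIterate a r c u
  set τ := ∑ i, a i
  have bd : ∀ n, (x n).im ≤ τ / u.im := fun n => by
    have i1 := (mem n).2
    have i2 := Complex.abs_im_le_norm (x n)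
    rw [abs_of_pos (mem n).1] at i2
    rw [le_div_iff₀ hu]
    refine le_of_mul_le_mul_left ?_ (mem n).1
    have := mul_le_mul_of_nonneg_left (pow_le_pow_left₀ (mem n).1.le i2 2) hu.le
    nlinarith
  set K := ‖x 1 - x 0‖ ^ 2 / ((x 1).im * (x 0).im)
  have hK : 0 ≤ K := div_nonneg (sq_nonneg _) (mul_pos (mem 1).1 (mem 0).1).le
  have step : ∀ n, ‖x (n + 1) - x n‖ ^ 2 ≤ K * (ρ ^ n) ^ 2 * ((x (n + 1)).im * (x n).im) := by
    intro n
    induction n with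
    | zero =>
      have := (mul_pos (mem 1).1 (mem 0).1).ne'
      simp only [zero_add, pow_zero, one_pow, mul_one, K]
      rw [div_mul_cancel₀ _ this]
    | succ n ih =>
      have c1 := norm_resolventMap_sub_sq_le ha hr hc hu (mem (n + 1)).1 (mem n).1
      have q1 := contractionFactor_nonneg ha hr hc u (x (n + 1))
      have q2 := contractionFactor_nonneg ha hr hc u (x n)
      have r1 := hρ _ (mem (n + 1)).1 (mem (n + 1)).2
      have r2 := hρ _ (mem n).1 (mem n).2
      calc ‖x (n + 1 + 1) - x (n + 1)‖ ^ 2 ≤ _ := c1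
        _ ≤ K * (ρ ^ n) ^ 2 * ((x (n + 1)).im * (x n).im) * _ :=
            mul_le_mul_of_nonneg_right ih (mul_nonneg q1 q2)
        _ = K * (ρ ^ n) ^ 2 * ((contractionFactor a r c u (x (n + 1)) * (x (n + 1)).im) *
              (contractionFactor a r c u (x n) * (x n).im)) := by ring
        _ ≤ K * (ρ ^ n) ^ 2 * ((ρ * (x (n + 1 + 1)).im) * (ρ * (x (n + 1)).im)) := by
            refine mul_le_mul_of_nonneg_left (mul_le_mul r1 r2 ?_ ?_) (by positivity)
            · exact mul_nonneg q2 (mem n).1.le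
            · exact mul_nonneg h0 (mem (n + 2)).1.le
        _ = _ := by ring
  refine cauchySeq_of_le_geometric ρ (Real.sqrt K * (τ / u.im)) h1 fun n => ?_
  rw [dist_comm, dist_eq_norm]
  refine abs_le_of_sq_le_sq' ?_ (by positivity) |>.2
  refine (step n).trans ?_
  have e : (Real.sqrt K * (τ / u.im) * ρ ^ n) ^ 2 =
      K * (ρ ^ n) ^ 2 * ((τ / u.im) * (τ / u.im)) := by
    rw [mul_pow, mul_pow, Real.sq_sqrt hK]; ring
  rw [e]
  exact mul_le_mul_of_nonneg_left (mul_le_mul (bd _) (bd _) (mem n).1.le (by positivity))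
    (by positivity)

/-- The iterates converge to a fixed point in the upper half-plane. -/
theorem exists_tendsto_resolventIterate [Nonempty ι] (ha : ∀ i, 0 < a i) (hr : ∀ i, 0 < r i)
    (hc : 0 < c) (hu : 0 < u.im) :
    ∃ h : ℂ, 0 < h.im ∧ resolventMap a r c u h = h ∧
      Tendsto (resolventIterate a r c u) atTop (𝓝 h) := by
  obtain ⟨h, hlim⟩ := cauchySeq_tendsto_of_complete (cauchySeq_resolventIterate ha hr hc hu)
  have mem := resolventIterate_mem ha hr hc hu
  have hτ := sum_pos_of_pos ha
  have hS : u.im * ‖h‖ ^ 2 ≤ (∑ i, a i) * h.im :=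
    le_of_tendsto_of_tendsto' ((hlim.norm.pow 2).const_mul _)
      (((Complex.continuous_im.tendsto h).comp hlim).const_mul _) fun n => (mem n).2
  have hdich : 0 < h.im ∨ h = 0 := by
    by_cases h0 : h = 0
    · exact Or.inr h0
    · left
      have : 0 < u.im * ‖h‖ ^ 2 := by have := norm_pos_iff.2 h0; positivity
      exact pos_of_mul_pos_right (this.trans_le hS) hτ.le
  have hfix : resolventMap a r c u h = h :=
    tendsto_nhds_unique ((continuousAt_resolventMap hc hu hr hdich).tendsto.comp hlim)
      (hlim.comp (tendsto_add_atTop_nat 1))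
  rcases hdich with h1 | rfl
  -- Zero is excluded because `Φ(0) = -τ / u` does not vanish.
  · exact ⟨h, h1, hfix, hlim⟩
  · exfalso
    rw [resolventMap_zero] at hfix
    have h0 : u ≠ 0 := by rintro rfl; simp at hu
    have := div_ne_zero (neg_ne_zero.2 (Complex.ofReal_ne_zero.2 hτ.ne')) h0
    exact this hfix

end

/-! ### The iterates as Stieltjes transforms of finitely many atoms. -/

/-- A diagonal entry of the resolvent of a real symmetric matrix is the Stieltjes transform of
finitely many atoms. -/
theorem exists_atoms_of_isHermitian {J : Type*} [Fintype J] [DecidableEq J] {A : Matrix J J ℝ}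
    (hA : A.IsHermitian) (o : J) :
    ∃ q l : J → ℝ, (∀ k, 0 ≤ q k) ∧ ∑ k, q k = 1 ∧ ∑ k, q k * l k ^ 2 = ∑ k, A o k ^ 2 ∧
      ∀ u : ℂ, u.im ≠ 0 → ∀ x : J → ℂ,
        (∀ j, ∑ k, (A j k : ℂ) * x k - u * x j = if j = o then 1 else 0) →
        x o = ∑ k, (q k : ℂ) / (l k - u) := by
  obtain ⟨U, l, hU, hAU⟩ : ∃ (U : Matrix J J ℝ) (l : J → ℝ), U * U.transpose = 1 ∧
      A * U = U * Matrix.diagonal l := by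
    have hU : (hA.eigenvectorUnitary : Matrix J J ℝ) * star (hA.eigenvectorUnitary : Matrix J J ℝ)
        = 1 := Unitary.coe_mul_star_self _
    refine ⟨hA.eigenvectorUnitary, hA.eigenvalues, ?_, ?_⟩
    · rwa [Matrix.star_eq_conjTranspose, Matrix.conjTranspose_eq_transpose_of_trivial] at hU
    · have h1 := hA.spectral_theorem
      rw [Unitary.conjStarAlgAut_apply] at h1
      refine (congrArg (· * (hA.eigenvectorUnitary : Matrix J J ℝ)) h1).trans ?_
      rw [mul_assoc, Unitary.coe_star_mul_self, mul_one]
      rfl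
  have hUe : ∀ i j, ∑ k, U i k * U j k = if i = j then 1 else 0 := fun i j => by
    have := congrFun (congrFun hU i) j
    simpa [Matrix.mul_apply, Matrix.one_apply] using this
  have hAUe : ∀ i k, ∑ j, A i j * U j k = U i k * l k := fun i k => by
    have := congrFun (congrFun hAU i) k
    simpa [Matrix.mul_apply, Matrix.diagonal_apply] using this
  -- The masses form the spectral measure of the basis vector `o`; its second moment is `(A²)ₒₒ`,
  -- the squared norm of row `o`.
  refine ⟨fun k => U o k ^ 2, l, fun k => sq_nonneg _, ?_, ?_, ?_⟩
  · simpa [pow_two] using hUe o o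
  · have h1 : (A * U) * (A * U).transpose = A * A.transpose := by
      rw [Matrix.transpose_mul, mul_assoc, ← mul_assoc U, hU, one_mul]
    have h2 := congrFun (congrFun h1 o) o
    simp only [Matrix.mul_apply, Matrix.transpose_apply, hAUe] at h2
    calc _ = ∑ k, U o k * l k * (U o k * l k) := Finset.sum_congr rfl fun k _ => by ring
      _ = _ := h2
      _ = _ := Finset.sum_congr rfl fun k _ => by ring
  · intro u hu x hx
    have hne : ∀ k, (l k : ℂ) - u ≠ 0 := fun k H => hu (by
      have := congrArg Complex.im H
      simpa using this)
    have hy : ∀ k, ∑ j, (U j k : ℂ) * x j = U o k / (l k - u) := fun k => by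
      rw [eq_div_iff (hne k)]
      have h1 : ∑ j, (U j k : ℂ) * (∑ m, (A j m : ℂ) * x m - u * x j) = U o k := by
        simp [hx]
      have h2 : ∑ j, (U j k : ℂ) * ∑ m, (A j m : ℂ) * x m = l k * ∑ m, (U m k : ℂ) * x m := by
        simp_rw [Finset.mul_sum]
        rw [Finset.sum_comm]
        refine Finset.sum_congr rfl fun m _ => ?_
        have h3 : ∑ j, (A m j : ℂ) * U j k = U m k * l k := by exact_mod_cast hAUe m k
        have h4 : ∀ j, A j m = A m j := fun j => by
          simpa using hA.apply m j
        calc _ = (∑ j, (A m j : ℂ) * U j k) * x m := by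
              rw [Finset.sum_mul]
              exact Finset.sum_congr rfl fun j _ => by rw [h4]; ring
          _ = _ := by rw [h3]; ring
      simp_rw [mul_sub, Finset.sum_sub_distrib] at h1
      rw [h2] at h1
      have h5 : ∑ j, (U j k : ℂ) * (u * x j) = u * ∑ j, (U j k : ℂ) * x j := by
        rw [Finset.mul_sum]
        exact Finset.sum_congr rfl fun j _ => by ring
      rw [h5] at h1
      linear_combination h1
    have h6 : ∑ k, (U o k : ℂ) * ∑ j, (U j k : ℂ) * x j = x o := by
      simp_rw [Finset.mul_sum]
      rw [Finset.sum_comm]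
      have : ∀ j, ∑ k, (U o k : ℂ) * U j k = if o = j then 1 else 0 := fun j => by
        have := congrArg Complex.ofReal (hUe o j)
        simpa only [Complex.ofReal_sum, Complex.ofReal_mul, apply_ite Complex.ofReal,
          Complex.ofReal_one, Complex.ofReal_zero] using this
      simp_rw [← mul_assoc, ← Finset.sum_mul, this]
      simp
    rw [← h6]
    refine Finset.sum_congr rfl fun k _ => ?_
    rw [hy]
    push_cast
    ring

/-- The real symmetric matrix whose resolvent realises one step of the recursion: a vertex joined
to two rank-one perturbations of a diagonal matrix. -/
noncomputable def borderedMatrix {J : Type*} [DecidableEq J] (b c : ℝ) (s l : J → ℝ) :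
    Matrix (Option (J ⊕ J)) (Option (J ⊕ J)) ℝ
  | none, none => 0
  | none, some (Sum.inl j) => b * s j
  | none, some (Sum.inr j) => b * s j
  | some (Sum.inl j), none => b * s j
  | some (Sum.inr j), none => b * s j
  | some (Sum.inl j), some (Sum.inl k) => (if j = k then l j else 0) - c * s j * s k
  | some (Sum.inr j), some (Sum.inr k) => (if j = k then l j else 0) + c * s j * s k
  | some (Sum.inl _), some (Sum.inr _) => 0
  | some (Sum.inr _), some (Sum.inl _) => 0

theorem borderedMatrix_isHermitian {J : Type*} [DecidableEq J] (b c : ℝ) (s l : J → ℝ) :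
    (borderedMatrix b c s l).IsHermitian := by
  ext (_ | i | i) (_ | j | j) <;>
    simp only [Matrix.conjTranspose_apply, borderedMatrix, star_trivial]
  · by_cases h : i = j
    · subst h; ring
    · rw [if_neg h, if_neg (Ne.symm h)]; ring
  · by_cases h : i = j
    · subst h; ring
    · rw [if_neg h, if_neg (Ne.symm h)]; ring

/-- If `f` is the Stieltjes transform of finitely many atoms, so is `-1 / (u + r c f / (1 - c² f²))`,
with total mass one and explicit second moment. -/
theorem exists_atoms_dressedResolvent {J : Type} [Fintype J] {p l : J → ℝ} (hp : ∀ j, 0 ≤ p j)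
    {r c : ℝ} (hr : 0 < r) (hc : 0 < c) :
    ∃ (K : Type) (_ : Fintype K) (q m : K → ℝ), (∀ k, 0 ≤ q k) ∧ ∑ k, q k = 1 ∧
      ∑ k, q k * m k ^ 2 = r * c * ∑ j, p j ∧
      ∀ u f : ℂ, u.im ≠ 0 → f = ∑ j, (p j : ℂ) / (l j - u) → 1 - (c : ℂ) ^ 2 * f ^ 2 ≠ 0 →
        u + r * selfEnergy c f ≠ 0 → dressedResolvent c r u f = ∑ k, (q k : ℂ) / (m k - u) := by
  classical
  -- The choice of `b` comes from `r c f / (1 - c² f²) = b² (f / (1 - c f) + f / (1 + c f))`. By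
  -- Sherman–Morrison each summand arises from one rank-one perturbed block, and the Schur
  -- complement at `none` assembles them.
  set b := Real.sqrt (r * c / 2)
  have hb : b ^ 2 = r * c / 2 := Real.sq_sqrt (by positivity)
  set s : J → ℝ := fun j => Real.sqrt (p j)
  have hs : ∀ j, s j ^ 2 = p j := fun j => Real.sq_sqrt (hp j)
  obtain ⟨q, m, hq, hq1, hq2, hx⟩ := exists_atoms_of_isHermitian
    (borderedMatrix_isHermitian b c s l) none
  refine ⟨_, inferInstance, q, m, hq, hq1, ?_, ?_⟩
  · rw [hq2]
    simp only [Fintype.sum_option, Fintype.sum_sum_type, borderedMatrix, mul_pow, hs, hb,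
      ← Finset.mul_sum]
    ring
  · intro u f hu hf h1 h2
    have hne : ∀ k, (l k : ℂ) - u ≠ 0 := fun k H => hu (by
      have := congrArg Complex.im H
      simpa using this)
    have e1 : (1 - (c : ℂ) * f) * (1 + c * f) = 1 - (c : ℂ) ^ 2 * f ^ 2 := by ring
    have n1 : 1 - (c : ℂ) * f ≠ 0 := left_ne_zero_of_mul (e1 ▸ h1)
    have n2 : 1 + (c : ℂ) * f ≠ 0 := right_ne_zero_of_mul (e1 ▸ h1)
    have hbC : (b : ℂ) ^ 2 = r * c / 2 := by exact_mod_cast hb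
    have hsC : ∀ j, (s j : ℂ) ^ 2 = p j := fun j => by exact_mod_cast hs j
    set g := dressedResolvent c r u f with hg
    have hg1 : g * (u + r * selfEnergy c f) = -1 := by
      rw [hg, dressedResolvent, neg_mul, inv_mul_cancel₀ h2]
    have hS : ∑ k, (s k : ℂ) * (s k / (l k - u)) = f := by
      rw [hf]
      exact Finset.sum_congr rfl fun k _ => by rw [← mul_div_assoc, ← pow_two, hsC]
    have hsum : ∀ t : ℂ, ∑ k, (s k : ℂ) * (t * (s k / (l k - u))) = t * f := fun t => by
      rw [← hS, Finset.mul_sum]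
      exact Finset.sum_congr rfl fun k _ => by ring
    -- This is the column `none` of the resolvent, obtained by solving each block in terms of the
    -- entry `g`.
    have key := hx u hu (fun
      | none => g
      | some (Sum.inl j) => -(b * g / (1 - c * f)) * (s j / (l j - u))
      | some (Sum.inr j) => -(b * g / (1 + c * f)) * (s j / (l j - u))) ?_
    · exact key
    · rintro (_ | j | j)
      · simp only [Fintype.sum_option, Fintype.sum_sum_type, borderedMatrix, if_true,
          Complex.ofReal_mul, mul_assoc, ← Finset.mul_sum, hsum]
        have : selfEnergy c f = c * f / ((1 - (c : ℂ) * f) * (1 + c * f)) := by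
          rw [e1, selfEnergy]
        rw [this] at hg1
        field_simp at hg1 ⊢
        simp only [Complex.ofReal_zero]
        linear_combination (-2 * f * g) * hbC - hg1
      · simp only [Fintype.sum_option, Fintype.sum_sum_type, borderedMatrix,
          Complex.ofReal_mul, Complex.ofReal_sub, Complex.ofReal_zero, zero_mul,
          Finset.sum_const_zero, add_zero, sub_mul, Finset.sum_sub_distrib, mul_assoc,
          ← Finset.mul_sum, hsum, apply_ite Complex.ofReal, ite_mul, Finset.sum_ite_eq,
          Finset.mem_univ, reduceCtorEq, if_false, if_true]
        have := hne j
        field_simp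
        ring
      · simp only [Fintype.sum_option, Fintype.sum_sum_type, borderedMatrix,
          Complex.ofReal_mul, Complex.ofReal_add, Complex.ofReal_zero, zero_mul,
          Finset.sum_const_zero, zero_add, add_mul, Finset.sum_add_distrib, mul_assoc,
          ← Finset.mul_sum, hsum, apply_ite Complex.ofReal, ite_mul, Finset.sum_ite_eq,
          Finset.mem_univ, reduceCtorEq, if_false, if_true]
        have := hne j
        field_simp
        ring

theorem selfEnergy_neg (c : ℝ) (h : ℂ) : selfEnergy c (-h) = -selfEnergy c h := by
  simp [selfEnergy, neg_div]

theorem dressedResolvent_neg (c r : ℝ) (u h : ℂ) :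
    dressedResolvent c r (-u) (-h) = -dressedResolvent c r u h := by
  rw [dressedResolvent, dressedResolvent, selfEnergy_neg, mul_neg, ← neg_add, inv_neg]

section

variable {ι : Type} [Fintype ι] {a r : ι → ℝ} {c : ℝ}

theorem resolventIterate_neg (a r : ι → ℝ) (c : ℝ) (u : ℂ) (n : ℕ) :
    resolventIterate a r c (-u) n = -resolventIterate a r c u n := by
  induction n with
  | zero => simp [resolventIterate, resolventMap_zero, div_neg]
  | succ n ih => simp [resolventIterate, ih, resolventMap, dressedResolvent_neg]

variable [Nonempty ι]

/-- Both half-planes are needed, since the symmetrization below evaluates at `u` and at `-u`. -/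
theorem resolventIterate_nondegenerate (ha : ∀ i, 0 < a i) (hr : ∀ i, 0 < r i) (hc : 0 < c) (n : ℕ)
    {s : ℝ} (hs : 0 < s) {u : ℂ} (hu : u.im ≠ 0) :
    1 - (c : ℂ) ^ 2 * resolventIterate a r c u n ^ 2 ≠ 0 ∧
      u + s * selfEnergy c (resolventIterate a r c u n) ≠ 0 := by
  rcases lt_or_gt_of_ne hu with h | h
  · have h' : 0 < (-u).im := by simpa using h
    have h1 := (resolventIterate_mem ha hr hc h' n).1
    have h2 := one_sub_sq_ne_zero hc h1
    have h3 := add_mul_ne_zero_of_im hs.le h' (selfEnergy_im_pos hc h1).le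
    rw [resolventIterate_neg] at h2 h3
    refine ⟨by simpa using h2, fun H => h3 ?_⟩
    rw [selfEnergy_neg]
    linear_combination -H
  · have h1 := (resolventIterate_mem ha hr hc h n).1
    exact ⟨one_sub_sq_ne_zero hc h1,
      add_mul_ne_zero_of_im hs.le h (selfEnergy_im_pos hc h1).le⟩

/-- The iteration starts from a single atom at `0`. The atoms do not depend on `u`, which lets the
same ones serve at `-u`. -/
theorem exists_atoms_resolventIterate (ha : ∀ i, 0 < a i) (hr : ∀ i, 0 < r i) (hc : 0 < c)
    (n : ℕ) : ∃ (J : Type) (_ : Fintype J) (p l : J → ℝ), (∀ j, 0 ≤ p j) ∧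
      ∑ j, p j = ∑ i, a i ∧ ∀ u : ℂ, u.im ≠ 0 →
        resolventIterate a r c u n = ∑ j, (p j : ℂ) / (l j - u) := by
  induction n with
  | zero =>
    refine ⟨Unit, inferInstance, fun _ => ∑ i, a i, fun _ => 0, fun _ => (sum_pos_of_pos ha).le,
      by simp, fun u _ => ?_⟩
    simp [resolventIterate, resolventMap_zero, div_neg, neg_div]
  | succ n ih =>
    obtain ⟨J, _, p, l, hp, -, hf⟩ := ih
    choose K _ q m hq hq1 _ hG using fun i =>
      exists_atoms_dressedResolvent (l := l) hp (hr i) hc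
    refine ⟨Σ i, K i, inferInstance, fun x => a x.1 * q x.1 x.2, fun x => m x.1 x.2,
      fun x => mul_nonneg (ha _).le (hq _ _), ?_, fun u hu => ?_⟩
    · rw [Fintype.sum_sigma]
      simp [← Finset.mul_sum, hq1]
    · rw [Fintype.sum_sigma, resolventIterate, resolventMap]
      refine Finset.sum_congr rfl fun i _ => ?_
      have nd := resolventIterate_nondegenerate ha hr hc n (hr i) hu
      rw [hG i u _ hu (hf u hu) nd.1 nd.2, Finset.mul_sum]
      refine Finset.sum_congr rfl fun k _ => ?_
      push_cast
      ring

/-- Oddness in `u` permits averaging `1 / (m - u)` with `-1 / (m + u)`, which gives `u / (m² - u²)`.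
Atoms move to `m² ≥ 0` and the second moment becomes the mean. -/
theorem exists_atoms_sq_dressedResolvent (ha : ∀ i, 0 < a i) (hr : ∀ i, 0 < r i) (hc : 0 < c)
    {s : ℝ} (hs : 0 < s) (n : ℕ) :
    ∃ (K : Type) (_ : Fintype K) (q m : K → ℝ), (∀ k, 0 ≤ q k) ∧ ∑ k, q k = 1 ∧
      ∑ k, q k * m k ^ 2 = s * c * ∑ i, a i ∧ ∀ u : ℂ, u.im ≠ 0 → (u ^ 2).im ≠ 0 →
        dressedResolvent c s u (resolventIterate a r c u n) =
          u * ∑ k, (q k : ℂ) * (((m k ^ 2 : ℝ) : ℂ) - u ^ 2)⁻¹ := by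
  obtain ⟨J, _, p, l, hp, hp1, hf⟩ := exists_atoms_resolventIterate ha hr hc n
  obtain ⟨K, _, q, m, hq, hq1, hq2, hG⟩ := exists_atoms_dressedResolvent (l := l) hp hs hc
  refine ⟨K, inferInstance, q, m, hq, hq1, by rw [hq2, hp1], fun u hu hu2 => ?_⟩
  have nd := resolventIterate_nondegenerate ha hr hc n hs hu
  have e1 := hG u _ hu (hf u hu) nd.1 nd.2
  have hu' : (-u).im ≠ 0 := by simpa using hu
  have nd' := resolventIterate_nondegenerate ha hr hc n hs hu'
  have e2 := hG (-u) _ hu' (hf _ hu') nd'.1 nd'.2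
  rw [resolventIterate_neg, dressedResolvent_neg] at e2
  have e3 : dressedResolvent c s u (resolventIterate a r c u n) =
      (∑ k, (q k : ℂ) / (m k - u) - ∑ k, (q k : ℂ) / (m k - -u)) / 2 := by
    rw [← e1, ← e2]; ring
  rw [e3, ← Finset.sum_sub_distrib, Finset.mul_sum, Finset.sum_div]
  refine Finset.sum_congr rfl fun k _ => ?_
  have n1 : (m k : ℂ) - u ≠ 0 := fun H => hu (by simpa using congrArg Complex.im H)
  have n2 : (m k : ℂ) - -u ≠ 0 := fun H => hu (by simpa using congrArg Complex.im H)
  have n3 : ((m k ^ 2 : ℝ) : ℂ) - u ^ 2 = (m k - u) * (m k - -u) := by push_cast; ring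
  rw [n3]
  field_simp
  ring

end

/-! ### Limits of Stieltjes transforms and recovery of the mean. -/

theorem ofReal_sub_ne_zero {z : ℂ} (hz : 0 < z.im) (x : ℝ) : (x : ℂ) - z ≠ 0 := fun H => by
  have := congrArg Complex.im H
  simp at this
  exact hz.ne' this

theorem norm_inv_ofReal_sub_le {z : ℂ} (hz : 0 < z.im) (x : ℝ) :
    ‖((x : ℂ) - z)⁻¹‖ ≤ z.im⁻¹ := by
  rw [norm_inv]
  refine inv_anti₀ hz ?_
  have := Complex.abs_im_le_norm ((x : ℂ) - z)
  simpa [abs_of_pos hz] using this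

theorem continuous_inv_ofReal_sub {z : ℂ} (hz : 0 < z.im) :
    Continuous fun x : ℝ => ((x : ℂ) - z)⁻¹ :=
  Continuous.inv₀ (by fun_prop) (ofReal_sub_ne_zero hz)

theorem integrable_inv_ofReal_sub {z : ℂ} (hz : 0 < z.im) (μ : Measure ℝ) [IsFiniteMeasure μ] :
    Integrable (fun x : ℝ => ((x : ℂ) - z)⁻¹) μ :=
  Integrable.of_bound (continuous_inv_ofReal_sub hz).aestronglyMeasurable _
    (Eventually.of_forall (norm_inv_ofReal_sub_le hz))

/-- If the Stieltjes transforms of probability measures on `[0, ∞)` with bounded means converge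
pointwise, the limit is the Stieltjes transform of a probability measure on `[0, ∞)`. -/
theorem exists_measure_of_tendsto_stieltjes {μ : ℕ → Measure ℝ} [hμ : ∀ n, IsProbabilityMeasure (μ n)]
    (h0 : ∀ n, μ n (Set.Iio 0) = 0) {C : ENNReal} (hC : C ≠ ⊤)
    (hmean : ∀ n, ∫⁻ x, ENNReal.ofReal x ∂μ n ≤ C) {g : ℂ → ℂ}
    (hg : ∀ z : ℂ, 0 < z.im →
      Tendsto (fun n => ∫ x : ℝ, ((x : ℂ) - z)⁻¹ ∂μ n) atTop (𝓝 (g z))) :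
    ∃ ν : Measure ℝ, IsProbabilityMeasure ν ∧ ν (Set.Iio 0) = 0 ∧
      ∀ z : ℂ, 0 < z.im → ∫ x : ℝ, ((x : ℂ) - z)⁻¹ ∂ν = g z := by
  set P : ℕ → ProbabilityMeasure ℝ := fun n => ⟨μ n, hμ n⟩
  have tight : IsTightMeasureSet {((ν : ProbabilityMeasure ℝ) : Measure ℝ) | ν ∈ Set.range P} := by
    rw [isTightMeasureSet_iff_exists_isCompact_measure_compl_le]
    intro ε hε
    -- With `C < T ε`, Markov's inequality leaves mass at most `ε` beyond `T`.
    obtain ⟨T, hT⟩ := ENNReal.exists_nat_mul_gt hε.ne' hC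
    refine ⟨Set.Icc 0 T, isCompact_Icc, ?_⟩
    rintro _ ⟨_, ⟨n, rfl⟩, rfl⟩
    have hsub : (Set.Icc (0 : ℝ) T)ᶜ ⊆ Set.Iio 0 ∪ {x : ℝ | (T : ENNReal) ≤ ENNReal.ofReal x} := by
      intro x hx
      rw [Set.mem_compl_iff, Set.mem_Icc, not_and_or, not_le, not_le] at hx
      rcases hx with hx | hx
      · exact Or.inl hx
      · right
        rw [Set.mem_ofPred_eq, ← ENNReal.ofReal_natCast]
        exact ENNReal.ofReal_le_ofReal hx.le
    have hM : (T : ENNReal) * μ n {x : ℝ | (T : ENNReal) ≤ ENNReal.ofReal x} ≤ T * ε :=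
      (mul_meas_ge_le_lintegral ENNReal.measurable_ofReal _).trans ((hmean n).trans hT.le)
    have hT0 : (T : ENNReal) ≠ 0 := by rintro h; rw [h, zero_mul] at hT; exact not_lt_zero hT
    calc μ n (Set.Icc (0 : ℝ) T)ᶜ ≤ _ := measure_mono hsub
      _ ≤ _ := measure_union_le _ _
      _ ≤ ε := by
        rw [h0, zero_add]
        exact (ENNReal.mul_le_mul_iff_right hT0 (ENNReal.natCast_ne_top T)).1 hM
  -- Compactness is used along an ultrafilter finer than `atTop`; no subsequence is needed, since
  -- `hg` fixes the limits of the transforms.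
  obtain ⟨ν, -, hν⟩ := (isCompact_closure_of_isTightMeasureSet tight).ultrafilter_le_nhds
    ((hyperfilter ℕ).map P) (le_principal_iff.2 (Filter.mem_map.2 (Eventually.of_forall fun n =>
      subset_closure (Set.mem_range_self n))))
  have hlim : Tendsto P (hyperfilter ℕ) (𝓝 ν) := hν
  have hat : ((hyperfilter ℕ : Ultrafilter ℕ) : Filter ℕ) ≤ atTop := Nat.hyperfilter_le_atTop
  refine ⟨ν, inferInstance, ?_, fun z hz => ?_⟩
  · have := ProbabilityMeasure.le_liminf_measure_open_of_tendsto hlim (isOpen_Iio (a := (0 : ℝ)))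
    have h1 : ∀ n, (P n : Measure ℝ) (Set.Iio 0) = 0 := h0
    simp only [h1] at this
    simpa using this
  · rw [ProbabilityMeasure.tendsto_iff_forall_integral_rclike_tendsto ℂ] at hlim
    have h1 := hlim (BoundedContinuousFunction.ofNormedAddCommGroup
      (fun x : ℝ => ((x : ℂ) - z)⁻¹) (continuous_inv_ofReal_sub hz) _ (norm_inv_ofReal_sub_le hz))
    exact tendsto_nhds_unique h1 ((hg z hz).mono_left hat)

/-- The mean of a measure on `[0, ∞)` can be read off from its Stieltjes transform along the
imaginary axis. -/
theorem integrable_and_integral_eq_of_tendsto {ν : Measure ℝ} [IsProbabilityMeasure ν]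
    (h0 : ν (Set.Iio 0) = 0) {C : ℝ} (hC : 0 ≤ C) {y : ℕ → ℝ} (hy : ∀ n, 0 < y n)
    (hmono : Monotone y) (htop : Tendsto y atTop atTop)
    (hlim : Tendsto (fun n => -(y n * Complex.I) * (1 + (y n * Complex.I) *
      ∫ x : ℝ, ((x : ℂ) - y n * Complex.I)⁻¹ ∂ν)) atTop (𝓝 (C : ℂ))) :
    Integrable (fun x : ℝ => x) ν ∧ ∫ x, x ∂ν = C := by
  have hae : ∀ᵐ x ∂ν, 0 ≤ x := by
    rw [ae_iff]
    simpa [Set.Iio] using h0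
  -- `φ n x` is the real part of `-z (1 + z / (x - z))` at `z = i y n`. For `x ≥ 0` it increases to
  -- `x`, so monotone convergence yields the mean, integrability included.
  set φ : ℕ → ℝ → ℝ := fun n x => x / (1 + (x / y n) ^ 2)
  have hφc : ∀ n, Continuous (φ n) := fun n =>
    continuous_id.div (by fun_prop) fun x => by positivity
  have hI : ∀ n, 0 < ((y n : ℂ) * Complex.I).im := fun n => by simpa using hy n
  have hφeq : ∀ n (x : ℝ), φ n x = (-(y n * Complex.I) * (1 + (y n * Complex.I) *
      ((x : ℂ) - y n * Complex.I)⁻¹)).re := fun n x => by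
    have hne := ofReal_sub_ne_zero (hI n) x
    have hyn := (hy n).ne'
    have e : -((y n : ℂ) * Complex.I) * (1 + (y n * Complex.I) *
        ((x : ℂ) - y n * Complex.I)⁻¹) = -(y n * Complex.I) * x * ((x : ℂ) - y n * Complex.I)⁻¹ := by
      field_simp
      ring
    rw [e]
    simp only [φ, Complex.mul_re, Complex.mul_im, Complex.inv_re, Complex.inv_im, Complex.normSq_apply,
      Complex.neg_re, Complex.neg_im, Complex.ofReal_re, Complex.ofReal_im, Complex.I_re,
      Complex.I_im, Complex.sub_re, Complex.sub_im]
    have : (0 : ℝ) < x * x + y n * y n := by nlinarith [hy n, mul_self_nonneg x]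
    simp
    field_simp
    ring
  have hint : ∀ n, Integrable (fun x : ℝ => -(y n * Complex.I) * (1 + (y n * Complex.I) *
      ((x : ℂ) - y n * Complex.I)⁻¹)) ν := fun n =>
    ((integrable_const _).add ((integrable_inv_ofReal_sub (hI n) ν).const_mul _)).const_mul _
  have hφint : ∀ n, ∫ x, φ n x ∂ν = (-(y n * Complex.I) * (1 + (y n * Complex.I) *
      ∫ x : ℝ, ((x : ℂ) - y n * Complex.I)⁻¹ ∂ν)).re := fun n => by
    simp_rw [hφeq]
    have := integral_re (hint n)
    refine this.trans ?_
    rw [integral_const_mul, integral_add (integrable_const _)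
      ((integrable_inv_ofReal_sub (hI n) ν).const_mul _), integral_const_mul]
    simp
  have hφi : ∀ n, Integrable (φ n) ν := fun n => by
    have := (hint n).re
    refine this.congr (Eventually.of_forall fun x => ?_)
    exact (hφeq n x).symm
  have l1 : Tendsto (fun n => ∫ x, φ n x ∂ν) atTop (𝓝 C) := by
    simp_rw [hφint]
    exact (Complex.continuous_re.tendsto _).comp hlim
  have l2 : Tendsto (fun n => ∫⁻ x, ENNReal.ofReal (φ n x) ∂ν) atTop
      (𝓝 (∫⁻ x, ENNReal.ofReal x ∂ν)) := by
    refine lintegral_tendsto_of_tendsto_of_monotone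
      (fun n => ((hφc n).measurable.ennreal_ofReal).aemeasurable) ?_ ?_
    · filter_upwards [hae] with x hx n m hnm
      refine ENNReal.ofReal_le_ofReal ?_
      have := hy n
      have h2 := hmono hnm
      have h3 : 0 ≤ x / y m := div_nonneg hx (hy m).le
      simp only [φ]
      gcongr
    · refine Eventually.of_forall fun x => (ENNReal.continuous_ofReal.tendsto x).comp ?_
      have h1 : Tendsto (fun n => x / y n) atTop (𝓝 0) := htop.const_div_atTop x
      have h2 : Tendsto (φ · x) atTop (𝓝 (x / (1 + 0 ^ 2))) :=
        tendsto_const_nhds.div (tendsto_const_nhds.add (h1.pow 2)) (by norm_num)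
      simpa using h2
  have l3 : ∫⁻ x, ENNReal.ofReal x ∂ν = ENNReal.ofReal C := by
    refine tendsto_nhds_unique l2 ?_
    have : ∀ n, ∫⁻ x, ENNReal.ofReal (φ n x) ∂ν = ENNReal.ofReal (∫ x, φ n x ∂ν) := fun n => by
      refine (ofReal_integral_eq_lintegral_ofReal (hφi n) ?_).symm
      filter_upwards [hae] with x hx
      simp only [φ, Pi.zero_apply]
      positivity
    simp_rw [this]
    exact (ENNReal.continuous_ofReal.tendsto _).comp l1
  have hi : Integrable (fun x : ℝ => x) ν := by
    refine ⟨by fun_prop, ?_⟩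
    rw [hasFiniteIntegral_iff_ofReal hae, l3]
    exact ENNReal.ofReal_lt_top
  refine ⟨hi, ?_⟩
  rw [integral_eq_lintegral_of_nonneg_ae hae hi.1, l3, ENNReal.toReal_ofReal hC]

/-- The atomic measure with masses `q k` at the points `x k`. -/
noncomputable def atomicMeasure {K : Type*} [Fintype K] (q x : K → ℝ) : Measure ℝ :=
  ∑ k, ENNReal.ofReal (q k) • Measure.dirac (x k)

section

variable {K : Type*} [Fintype K] {q x : K → ℝ}

theorem isProbabilityMeasure_atomicMeasure (hq : ∀ k, 0 ≤ q k) (h1 : ∑ k, q k = 1) :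
    IsProbabilityMeasure (atomicMeasure q x) := by
  refine ⟨?_⟩
  simp only [atomicMeasure, Measure.coe_finsetSum, Finset.sum_apply, Measure.smul_apply,
    measure_univ, smul_eq_mul, mul_one]
  rw [← ENNReal.ofReal_sum_of_nonneg fun k _ => hq k, h1, ENNReal.ofReal_one]

theorem atomicMeasure_Iio (hx : ∀ k, 0 ≤ x k) : atomicMeasure q x (Set.Iio 0) = 0 := by
  simp only [atomicMeasure, Measure.coe_finsetSum, Finset.sum_apply, Measure.smul_apply,
    smul_eq_mul]
  refine Finset.sum_eq_zero fun k _ => ?_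
  rw [Measure.dirac_apply' _ measurableSet_Iio, Set.indicator_of_notMem (by simpa using hx k),
    mul_zero]

theorem lintegral_atomicMeasure (hq : ∀ k, 0 ≤ q k) (hx : ∀ k, 0 ≤ x k) :
    ∫⁻ t, ENNReal.ofReal t ∂atomicMeasure q x = ENNReal.ofReal (∑ k, q k * x k) := by
  rw [atomicMeasure, lintegral_finsetSum_measure,
    ENNReal.ofReal_sum_of_nonneg fun k _ => mul_nonneg (hq k) (hx k)]
  refine Finset.sum_congr rfl fun k _ => ?_
  rw [lintegral_smul_measure, lintegral_dirac, ENNReal.ofReal_mul (hq k), smul_eq_mul]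

theorem integral_atomicMeasure (hq : ∀ k, 0 ≤ q k) {z : ℂ} (hz : 0 < z.im) :
    ∫ t : ℝ, ((t : ℂ) - z)⁻¹ ∂atomicMeasure q x = ∑ k, (q k : ℂ) * ((x k : ℂ) - z)⁻¹ := by
  rw [atomicMeasure, integral_finsetSum_measure fun k _ =>
    (integrable_inv_ofReal_sub hz _).smul_measure ENNReal.ofReal_ne_top]
  refine Finset.sum_congr rfl fun k _ => ?_
  rw [integral_smul_measure, integral_dirac, ENNReal.toReal_ofReal (hq k)]
  rfl

end

/-! ### Limit measures attached to the fixed point. -/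

theorem exists_sq_eq_of_im_pos {z : ℂ} (hz : 0 < z.im) :
    ∃ u : ℂ, 0 < u.re ∧ 0 < u.im ∧ u ^ 2 = z := by
  obtain ⟨v, hv⟩ := IsAlgClosed.exists_pow_nat_eq z two_pos
  have h1 : 2 * (v.re * v.im) = z.im := by
    rw [← hv, pow_two, Complex.mul_im]; ring
  have h2 : 0 < v.re * v.im := by linarith
  rcases pos_and_pos_or_neg_and_neg_of_mul_pos h2 with h | h
  · exact ⟨v, h.1, h.2, hv⟩
  · exact ⟨-v, by simpa using h.1, by simpa using h.2, by simpa using hv⟩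

theorem eq_of_sq_eq_sq_of_im_pos {u v : ℂ} (hu : 0 < u.im) (hv : 0 < v.im) (h : u ^ 2 = v ^ 2) :
    u = v := by
  rcases sq_eq_sq_iff_eq_or_eq_neg.1 h with h | h
  · exact h
  · have := congrArg Complex.im h
    rw [Complex.neg_im] at this
    linarith

theorem continuousAt_dressedResolvent {c s : ℝ} (hc : 0 < c) (hs : 0 ≤ s) {u h : ℂ}
    (hu : 0 < u.im) (hh : 0 < h.im) : ContinuousAt (dressedResolvent c s u) h := by
  have h3 : ContinuousAt (selfEnergy c) h := by
    unfold selfEnergy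
    exact ContinuousAt.div (by fun_prop) (by fun_prop) (one_sub_sq_ne_zero hc hh)
  unfold dressedResolvent
  refine ContinuousAt.neg (ContinuousAt.inv₀ ?_
    (add_mul_ne_zero_of_im hs hu (selfEnergy_im_pos hc hh).le))
  fun_prop

section

variable {ι : Type} [Fintype ι] [Nonempty ι] {a r : ι → ℝ} {c : ℝ}

theorem norm_le_of_resolventMap_fixed (ha : ∀ i, 0 < a i) (hr : ∀ i, 0 < r i) (hc : 0 < c)
    {u h : ℂ} (hu : 0 < u.im) (hh : 0 < h.im) (hfix : resolventMap a r c u h = h) :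
    ‖h‖ ≤ (∑ i, a i) / u.im := by
  have h1 := norm_sq_resolventMap_le ha hr hc hu hh.le
  rw [hfix] at h1
  have hn : 0 < ‖h‖ := norm_pos_iff.2 (by rintro rfl; simp at hh)
  have h2 := mul_le_mul_of_nonneg_left (Complex.im_le_norm h) (sum_pos_of_pos ha).le
  rw [le_div_iff₀ hu]
  refine le_of_mul_le_mul_left ?_ hn
  linarith

/-- Asymptotics of the fixed point as `u → ∞`. -/
theorem tendsto_of_resolventMap_fixed (ha : ∀ i, 0 < a i) (hr : ∀ i, 0 < r i) (hc : 0 < c)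
    {u h : ℕ → ℂ} (hu : ∀ n, 0 < (u n).im) (hh : ∀ n, 0 < (h n).im)
    (hfix : ∀ n, resolventMap a r c (u n) (h n) = h n)
    (htop : Tendsto (fun n => (u n).im) atTop atTop) (s : ℝ) (hs : 0 < s) :
    Tendsto (fun n => -(u n ^ 2) * (1 + u n * dressedResolvent c s (u n) (h n))) atTop
      (𝓝 ((c * (∑ i, a i) * s : ℝ) : ℂ)) := by
  have hne : ∀ n, u n ≠ 0 := fun n H => by have := hu n; simp [H] at this
  have h0 : Tendsto h atTop (𝓝 0) := by
    rw [tendsto_zero_iff_norm_tendsto_zero]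
    exact squeeze_zero (fun n => norm_nonneg _)
      (fun n => norm_le_of_resolventMap_fixed ha hr hc (hu n) (hh n) (hfix n))
      (htop.const_div_atTop _)
  have hui : Tendsto (fun n => (u n)⁻¹) atTop (𝓝 0) := by
    rw [tendsto_zero_iff_norm_tendsto_zero]
    refine squeeze_zero (fun n => norm_nonneg _) (fun n => ?_) (tendsto_inv_atTop_zero.comp htop)
    rw [norm_inv]
    exact inv_anti₀ (hu n) (Complex.im_le_norm _)
  have hden : Tendsto (fun n => 1 - (c : ℂ) ^ 2 * h n ^ 2) atTop (𝓝 1) := by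
    simpa using (tendsto_const_nhds (x := (1 : ℂ))).sub ((h0.pow 2).const_mul ((c : ℂ) ^ 2))
  have hw : Tendsto (fun n => selfEnergy c (h n)) atTop (𝓝 0) := by
    have := (h0.const_mul (c : ℂ)).div hden one_ne_zero
    rw [mul_zero, zero_div] at this
    exact this
  have hinv : ∀ s : ℝ, Tendsto (fun n => (1 + s * (selfEnergy c (h n) * (u n)⁻¹))⁻¹) atTop
      (𝓝 1) := fun s => by
    simpa using ((tendsto_const_nhds (x := (1 : ℂ))).add ((hw.mul hui).const_mul (s : ℂ))).inv₀
      (by simp)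
  have hG : ∀ s : ℝ, ∀ n, u n * dressedResolvent c s (u n) (h n) =
      -(1 + s * (selfEnergy c (h n) * (u n)⁻¹))⁻¹ := fun s n => by
    have : u n + s * selfEnergy c (h n) = u n * (1 + s * (selfEnergy c (h n) * (u n)⁻¹)) := by
      have := hne n
      field_simp
    rw [dressedResolvent, this, mul_inv, mul_neg, ← mul_assoc, mul_inv_cancel₀ (hne n), one_mul]
  have huh : Tendsto (fun n => u n * h n) atTop (𝓝 (-(∑ i, a i : ℝ) : ℂ)) := by
    have e : ∀ n, u n * h n =
        ∑ i, (a i : ℂ) * -(1 + r i * (selfEnergy c (h n) * (u n)⁻¹))⁻¹ := fun n => by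
      conv_lhs => rw [← hfix n]
      rw [resolventMap, Finset.mul_sum]
      refine Finset.sum_congr rfl fun i _ => ?_
      rw [← hG]; ring
    simp_rw [e]
    have := tendsto_finsetSum (Finset.univ : Finset ι) fun i _ =>
      ((hinv (r i)).neg).const_mul (a i : ℂ)
    simpa using this
  have huw : Tendsto (fun n => u n * selfEnergy c (h n)) atTop
      (𝓝 (c * (-(∑ i, a i : ℝ) : ℂ))) := by
    have := (huh.const_mul (c : ℂ)).div hden one_ne_zero
    rw [div_one] at this
    refine this.congr fun n => ?_
    rw [selfEnergy]
    simp only [Pi.div_apply]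
    ring
  -- With `w = selfEnergy c h`, the expression equals `-s u w (1 + s w / u)⁻¹`, and `u w → -c τ`
  -- because `u h → -τ`.
  have hfin := (((huw.const_mul (s : ℂ))).mul (hinv s)).neg
  have e2 : -((s : ℂ) * (c * (-(∑ i, a i : ℝ) : ℂ)) * 1) = ((c * (∑ i, a i) * s : ℝ) : ℂ) := by
    push_cast; ring
  rw [e2] at hfin
  refine hfin.congr fun n => ?_
  rw [hG]
  have n1 : 1 + (s : ℂ) * (selfEnergy c (h n) * (u n)⁻¹) ≠ 0 := by
    intro H
    have := add_mul_ne_zero_of_im hs.le (hu n) (selfEnergy_im_pos hc (hh n)).le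
    apply this
    have hn := hne n
    field_simp at H
    linear_combination H
  have hn := hne n
  obtain ⟨d, hd⟩ : ∃ d, d = 1 + (s : ℂ) * (selfEnergy c (h n) * (u n)⁻¹) := ⟨_, rfl⟩
  have hd2 : u n * (d - 1) = s * selfEnergy c (h n) := by
    rw [hd]
    field_simp
    ring
  rw [← hd] at n1 ⊢
  field_simp
  linear_combination hd2

/-- The functions `-1 / (u (u + rᵢ c h / (1 - c² h²)))` of `z = u²`, at the fixed point `h`, are the
Stieltjes transforms of probability measures on `[0, ∞)` with mean `c (∑ aⱼ) rᵢ`. -/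
theorem exists_measures_of_resolventMap (ha : ∀ i, 0 < a i) (hr : ∀ i, 0 < r i) (hc : 0 < c) :
    ∃ ν : ι → Measure ℝ, (∀ i, IsProbabilityMeasure (ν i)) ∧ (∀ i, ν i (Set.Iio 0) = 0) ∧
      (∀ i, Integrable (fun x : ℝ => x) (ν i)) ∧ (∀ i, ∫ x, x ∂ν i = c * (∑ j, a j) * r i) ∧
      ∀ u : ℂ, 0 < u.im → 0 < (u ^ 2).im → ∃ h : ℂ, 0 < h.im ∧ resolventMap a r c u h = h ∧
        ∀ i, dressedResolvent c (r i) u h = u * ∫ x : ℝ, ((x : ℂ) - u ^ 2)⁻¹ ∂ν i := by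
  choose! H hH hfix hlim using fun (u : ℂ) (hu : 0 < u.im) =>
    exists_tendsto_resolventIterate (u := u) ha hr hc hu
  choose! v hv1 hv2 hv3 using fun (z : ℂ) (hz : 0 < z.im) => exists_sq_eq_of_im_pos hz
  have hvu : ∀ u : ℂ, 0 < u.im → 0 < (u ^ 2).im → v (u ^ 2) = u := fun u h1 h2 =>
    eq_of_sq_eq_sq_of_im_pos (hv2 _ h2) h1 (hv3 _ h2)
  have hne : ∀ u : ℂ, 0 < u.im → u ≠ 0 := fun u hu h => by simp [h] at hu
  have hτ := sum_pos_of_pos ha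
  have main : ∀ i, ∃ ν : Measure ℝ, IsProbabilityMeasure ν ∧ ν (Set.Iio 0) = 0 ∧
      ∀ z : ℂ, 0 < z.im → ∫ x : ℝ, ((x : ℂ) - z)⁻¹ ∂ν =
        (v z)⁻¹ * dressedResolvent c (r i) (v z) (H (v z)) := fun i => by
    choose K _ q m hq hq1 hq2 hG using fun n =>
      exists_atoms_sq_dressedResolvent ha hr hc (hr i) n
    have hx : ∀ n k, 0 ≤ m n k ^ 2 := fun n k => sq_nonneg _
    have hprob : ∀ n, IsProbabilityMeasure (atomicMeasure (q n) fun k => m n k ^ 2) :=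
      fun n => isProbabilityMeasure_atomicMeasure (hq n) (hq1 n)
    refine exists_measure_of_tendsto_stieltjes
      (μ := fun n => atomicMeasure (q n) fun k => m n k ^ 2) (fun n => atomicMeasure_Iio (hx n))
      (ENNReal.ofReal_ne_top (r := r i * c * ∑ j, a j))
      (fun n => ?_) fun z hz => ?_
    · rw [lintegral_atomicMeasure (hq n) (hx n), hq2]
    · have l1 := ((continuousAt_dressedResolvent hc (hr i).le (hv2 z hz)
        (hH _ (hv2 z hz))).tendsto.comp (hlim _ (hv2 z hz))).const_mul (v z)⁻¹
      refine l1.congr fun n => ?_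
      have h2 : ((v z) ^ 2).im ≠ 0 := by rw [hv3 z hz]; exact hz.ne'
      rw [integral_atomicMeasure (hq n) hz, Function.comp_apply, hG n _ (hv2 z hz).ne' h2,
        hv3 z hz, inv_mul_cancel_left₀ (hne _ (hv2 z hz))]
  choose ν hν1 hν2 hν3 using main
  have key : ∀ u : ℂ, 0 < u.im → 0 < (u ^ 2).im → ∀ i,
      dressedResolvent c (r i) u (H u) = u * ∫ x : ℝ, ((x : ℂ) - u ^ 2)⁻¹ ∂ν i :=
    fun u h1 h2 i => by
      rw [hν3 i _ h2, hvu u h1 h2, mul_inv_cancel_left₀ (hne u h1)]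
  have mean : ∀ i, Integrable (fun x : ℝ => x) (ν i) ∧ ∫ x, x ∂ν i = c * (∑ j, a j) * r i :=
    fun i => by
      -- Along this ray `u²` runs up the imaginary axis while `Im u → ∞`.
      set u : ℕ → ℂ := fun n => ((n : ℂ) + 1) * (1 + Complex.I)
      have hui : ∀ n, (u n).im = n + 1 := fun n => by simp [u]
      have hupos : ∀ n, 0 < (u n).im := fun n => by rw [hui]; positivity
      have hsq : ∀ n, u n ^ 2 = ((2 * ((n : ℝ) + 1) ^ 2 : ℝ) : ℂ) * Complex.I := fun n => by
        simp only [u]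
        push_cast
        linear_combination ((n : ℂ) + 1) ^ 2 * Complex.I_sq
      have hsq_im : ∀ n, 0 < (u n ^ 2).im := fun n => by
        rw [hsq, Complex.im_ofReal_mul, Complex.I_im, mul_one]
        positivity
      have hnat : Tendsto (fun n : ℕ => (n : ℝ) + 1) atTop atTop :=
        tendsto_atTop_add_const_right _ _ tendsto_natCast_atTop_atTop
      refine integrable_and_integral_eq_of_tendsto (hν2 i)
        (C := c * (∑ j, a j) * r i) (by have := hr i; positivity)
        (y := fun n => 2 * ((n : ℝ) + 1) ^ 2) (fun n => by positivity) ?_ ?_ ?_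
      · intro n m hnm
        have : (n : ℝ) ≤ m := by exact_mod_cast hnm
        simp only
        gcongr
      · exact ((tendsto_pow_atTop two_ne_zero).comp hnat).const_mul_atTop two_pos
      · have l := tendsto_of_resolventMap_fixed ha hr hc hupos (fun n => hH _ (hupos n))
          (fun n => hfix _ (hupos n)) (by simp_rw [hui]; exact hnat) (r i) (hr i)
        refine l.congr fun n => ?_
        rw [← hsq, key _ (hupos n) (hsq_im n)]
        ring
  exact ⟨ν, hν1, hν2, fun i => (mean i).1, fun i => (mean i).2, fun u h1 h2 =>
    ⟨H u, hH u h1, hfix u h1, key u h1 h2⟩⟩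

end

/-! ### Positivity and lower bounds for Stieltjes transforms. -/

section

variable {ν : Measure ℝ} [IsProbabilityMeasure ν]

theorem inv_ofReal_sub_im (x : ℝ) (z : ℂ) :
    (((x : ℂ) - z)⁻¹).im = z.im / Complex.normSq (x - z) := by
  rw [Complex.inv_im]; simp

/-- Since `z / (x - z) = x / (x - z) - 1`, the imaginary part is the integral of `x` against a
positive density; the positive mean rules out a point mass at `0`. -/
theorem im_mul_integral_pos (h0 : ν (Set.Iio 0) = 0) (hi : Integrable (fun x : ℝ => x) ν)
    (hm : 0 < ∫ x, x ∂ν) {z : ℂ} (hz : 0 < z.im) :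
    0 < (z * ∫ x : ℝ, ((x : ℂ) - z)⁻¹ ∂ν).im := by
  have hae : ∀ᵐ x ∂ν, 0 ≤ x := by
    rw [ae_iff]
    simpa [Set.Iio] using h0
  have hint : Integrable (fun x : ℝ => z * ((x : ℂ) - z)⁻¹) ν :=
    (integrable_inv_ofReal_sub hz ν).const_mul z
  have e : ∀ x : ℝ, (z * ((x : ℂ) - z)⁻¹).im = x * (z.im / Complex.normSq (x - z)) := fun x => by
    have hne := ofReal_sub_ne_zero hz x
    have : z * ((x : ℂ) - z)⁻¹ = x * ((x : ℂ) - z)⁻¹ - 1 := by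
      field_simp
      ring
    rw [this, Complex.sub_im, Complex.im_ofReal_mul, inv_ofReal_sub_im]
    simp
  have hpos : ∀ x : ℝ, 0 < z.im / Complex.normSq (x - z) := fun x =>
    div_pos hz (Complex.normSq_pos.2 (ofReal_sub_ne_zero hz x))
  have him : (z * ∫ x : ℝ, ((x : ℂ) - z)⁻¹ ∂ν).im = ∫ x : ℝ, (z * ((x : ℂ) - z)⁻¹).im ∂ν := by
    rw [← integral_const_mul]
    exact (integral_im hint).symm
  have hint' : Integrable (fun x : ℝ => (z * ((x : ℂ) - z)⁻¹).im) ν := hint.im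
  rw [him]
  rw [integral_pos_iff_support_of_nonneg_ae hae hi] at hm
  rw [integral_pos_iff_support_of_nonneg_ae _ hint']
  · convert hm using 2
    ext x
    rw [Function.mem_support, Function.mem_support, e, mul_ne_zero_iff]
    exact and_iff_left (hpos x).ne'
  · filter_upwards [hae] with x hx
    rw [e]
    exact mul_nonneg hx (hpos x).le

/-- A quantitative lower bound on the imaginary part of the Stieltjes transform of a probability
measure on `[0, ∞)` whose mean is at most `K / 2`. -/
theorem le_im_integral_inv (h0 : ν (Set.Iio 0) = 0) (hi : Integrable (fun x : ℝ => x) ν) {K : ℝ}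
    (hK : 0 < K) (hm : 2 * ∫ x, x ∂ν ≤ K) {z : ℂ} (hz : 0 < z.im) :
    z.im / (4 * (K ^ 2 + ‖z‖ ^ 2)) ≤ (∫ x : ℝ, ((x : ℂ) - z)⁻¹ ∂ν).im := by
  have hae : ∀ᵐ x ∂ν, 0 ≤ x := by
    rw [ae_iff]
    simpa [Set.Iio] using h0
  have him : (∫ x : ℝ, ((x : ℂ) - z)⁻¹ ∂ν).im = ∫ x : ℝ, (((x : ℂ) - z)⁻¹).im ∂ν :=
    (integral_im (integrable_inv_ofReal_sub hz ν)).symm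
  rw [him]
  set D := 2 * (K ^ 2 + ‖z‖ ^ 2)
  have hD : 0 < D := by positivity
  -- The linear factor `1 - x / K` minorizes the indicator of `[0, K]`, where `‖x - z‖² ≤ D`. Its
  -- integral is at least `1 / 2` by the bound on the mean.
  have hlow : ∀ x : ℝ, 0 ≤ x → z.im / D * (1 - x / K) ≤ (((x : ℂ) - z)⁻¹).im := fun x hx => by
    rw [inv_ofReal_sub_im]
    have hn : 0 < Complex.normSq (x - z) := Complex.normSq_pos.2 (ofReal_sub_ne_zero hz x)
    by_cases hxK : x ≤ K
    · have h1 : Complex.normSq (x - z) ≤ D := by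
        simp only [D]
        rw [Complex.sq_norm, Complex.normSq_apply, Complex.normSq_apply]
        simp
        nlinarith [sq_nonneg (x + z.re)]
      calc _ ≤ z.im / D * 1 := by
            refine mul_le_mul_of_nonneg_left ?_ (by positivity)
            have : 0 ≤ x / K := by positivity
            linarith
        _ ≤ _ := by
            rw [mul_one]
            gcongr
    · have : 1 - x / K ≤ 0 := by
        rw [sub_nonpos, one_le_div hK]
        exact (not_le.1 hxK).le
      exact (mul_nonpos_of_nonneg_of_nonpos (by positivity) this).trans (by positivity)
  have hle : ∫ x : ℝ, z.im / D * (1 - x / K) ∂ν ≤ ∫ x : ℝ, (((x : ℂ) - z)⁻¹).im ∂ν := by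
    refine integral_mono_ae (((integrable_const _).sub (hi.div_const K)).const_mul _)
      (integrable_inv_ofReal_sub hz ν).im ?_
    filter_upwards [hae] with x hx using hlow x hx
  refine le_trans ?_ hle
  rw [integral_const_mul, integral_sub (integrable_const _) (hi.div_const K), integral_div]
  simp only [integral_const, probReal_univ, smul_eq_mul, mul_one]
  have h2 : 1 / 2 ≤ 1 - (∫ x, x ∂ν) / K := by
    have : (∫ x, x ∂ν) / K ≤ 1 / 2 := by
      rw [div_le_iff₀ hK]; linarith
    linarith
  calc _ = z.im / D * (1 / 2) := by
        simp only [D]; field_simp; norm_num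
    _ ≤ _ := mul_le_mul_of_nonneg_left h2 (by positivity)

end

/-! ### Complex and matrix-valued measures built from positive ones. -/

/-- The additive map `x ↦ p x` from `ℝ` to `ℂ`. -/
noncomputable def ofRealMulHom (p : ℂ) : ℝ →+ ℂ :=
  (AddMonoidHom.mulLeft p).comp Complex.ofRealHom.toAddMonoidHom

theorem ofRealMulHom_apply (p : ℂ) (x : ℝ) : ofRealMulHom p x = p * x := rfl

theorem continuous_ofRealMulHom (p : ℂ) : Continuous (ofRealMulHom p) := by
  change Continuous fun x : ℝ => p * (x : ℂ)
  fun_prop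

section

/-- The complex measure `p ν`, for a finite positive measure `ν` and a complex number `p`. -/
noncomputable def scaledMeasure (ν : Measure ℝ) [IsFiniteMeasure ν] (p : ℂ) : ComplexMeasure ℝ :=
  ν.toSignedMeasure.mapRange (ofRealMulHom p) (continuous_ofRealMulHom p)

variable {ν : Measure ℝ} [IsFiniteMeasure ν]

theorem scaledMeasure_apply (p : ℂ) {S : Set ℝ} (hS : MeasurableSet S) :
    scaledMeasure ν p S = p * ν.real S := by
  rw [scaledMeasure, VectorMeasure.mapRange_apply, Measure.toSignedMeasure_apply_measurable hS,
    ofRealMulHom_apply]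

theorem variation_scaledMeasure_le (p : ℂ) : (scaledMeasure ν p).variation ≤ ‖p‖ₑ • ν := by
  refine VectorMeasure.variation_le_of_forall_enorm_le fun S hS => ?_
  rw [scaledMeasure_apply p hS, enorm_mul, Measure.smul_apply, smul_eq_mul]
  refine mul_le_mul_right (le_of_eq ?_) _
  rw [← ofReal_norm, Complex.norm_real, Real.norm_of_nonneg measureReal_nonneg, ofReal_measureReal]

theorem integrable_scaledMeasure (p : ℂ) {f : ℝ → ℂ} (hf : Integrable f ν) :
    (scaledMeasure ν p).Integrable f :=
  (hf.smul_measure (c := ‖p‖ₑ) enorm_ne_top).mono_measure (variation_scaledMeasure_le p)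

/-- Domination of the variation by `‖p‖ ν` allows both sides to be viewed as continuous functionals
on integrable functions for `ν`; they agree on indicators. -/
theorem integral_scaledMeasure_of_mul {B : ℂ →L[ℝ] ℂ →L[ℝ] ℂ} (hB : ∀ x y, B x y = x * y) (p : ℂ)
    {f : ℝ → ℂ} (hf : Integrable f ν) :
    (scaledMeasure ν p).integral f B = p * ∫ x, f x ∂ν := by
  have hT : DominatedFinMeasAdditive ν ((scaledMeasure ν p).transpose B) (‖B‖ * ‖p‖) := by
    refine ⟨fun s t hs ht _ _ hd => cbmApplyMeasure_union _ B hs ht hd, fun s hs _ => ?_⟩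
    refine (norm_cbmApplyMeasure_le _ _ _).trans ?_
    rw [scaledMeasure_apply p hs, norm_mul, Complex.norm_real,
      Real.norm_of_nonneg measureReal_nonneg, mul_assoc]
  have e : (scaledMeasure ν p).integral f B =
      setToFun ν ((scaledMeasure ν p).transpose B) hT f := by
    rw [VectorMeasure.integral_eq_setToFun]
    exact (setToFun_congr_measure_of_integrable _ enorm_ne_top (variation_scaledMeasure_le p)
      _ _ f hf).symm
  rw [e]
  refine Integrable.induction (fun f : ℝ → ℂ => setToFun ν ((scaledMeasure ν p).transpose B) hT f =
    p * ∫ x, f x ∂ν) ?_ ?_ ?_ ?_ hf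
  · intro c s hs hμs
    rw [setToFun_indicator_const hT hs hμs.ne, integral_indicator_const c hs]
    have : (scaledMeasure ν p).transpose B s c = B c (scaledMeasure ν p s) := rfl
    rw [this, hB, scaledMeasure_apply p hs, Complex.real_smul]
    ring
  · intro f g _ hf hg h1 h2
    rw [setToFun_add hT hf hg, h1, h2, ← mul_add, ← integral_add hf hg]
    rfl
  · exact isClosed_eq (continuous_setToFun hT) (continuous_const.mul continuous_integral)
  · intro f g hfg _ h1
    rw [← setToFun_congr_ae hT hfg, h1, integral_congr_ae hfg]

theorem integral_scaledMeasure (p : ℂ) {f : ℝ → ℂ} (hf : Integrable f ν) :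
    (scaledMeasure ν p).integral f (ContinuousLinearMap.mul ℝ ℂ) = p * ∫ x, f x ∂ν :=
  integral_scaledMeasure_of_mul (fun _ _ => rfl) p hf

end

section

variable {m : ℕ} (U : Matrix (Fin m) (Fin m) ℂ)

/-- The additive map `x ↦ U diag(0, …, x, …, 0) Uᴴ`. -/
noncomputable def conjSingleHom (i : Fin m) : ℝ →+ Matrix (Fin m) (Fin m) ℂ where
  toFun x := U * Matrix.diagonal (Pi.single i (x : ℂ)) * U.conjTranspose
  map_zero' := by simp
  map_add' x y := by
    rw [Complex.ofReal_add, Pi.single_add, ← add_mul, ← mul_add, Matrix.diagonal_add]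
    rfl

theorem conjSingleHom_apply (i : Fin m) (x : ℝ) :
    conjSingleHom U i x = U * Matrix.diagonal (Pi.single i (x : ℂ)) * U.conjTranspose := rfl

theorem conjSingleHom_apply_apply (i j k : Fin m) (x : ℝ) :
    conjSingleHom U i x j k = U j i * star (U k i) * x := by
  rw [conjSingleHom_apply, Matrix.mul_apply]
  simp only [Matrix.mul_diagonal, Matrix.conjTranspose_apply]
  rw [Finset.sum_eq_single i]
  · rw [Pi.single_eq_same]; ring
  · intro l _ hl
    rw [Pi.single_eq_of_ne hl]; ring
  · simp

theorem continuous_conjSingleHom (i : Fin m) : Continuous (conjSingleHom U i) := by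
  refine continuous_matrix fun j k => ?_
  simp_rw [conjSingleHom_apply_apply]
  fun_prop

/-- The matrix-valued measure `U diag(νᵢ) Uᴴ`. -/
noncomputable def conjDiagonalMeasure (ν : Fin m → Measure ℝ) [∀ i, IsFiniteMeasure (ν i)] :
    VectorMeasure ℝ (Matrix (Fin m) (Fin m) ℂ) :=
  ∑ i, (ν i).toSignedMeasure.mapRange (conjSingleHom U i) (continuous_conjSingleHom U i)

variable {ν : Fin m → Measure ℝ} [∀ i, IsFiniteMeasure (ν i)]

theorem conjDiagonalMeasure_apply {S : Set ℝ} (hS : MeasurableSet S) :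
    conjDiagonalMeasure U ν S =
      U * Matrix.diagonal (fun i => ((ν i).real S : ℂ)) * U.conjTranspose := by
  have h1 : conjDiagonalMeasure U ν S = ∑ i, conjSingleHom U i ((ν i).real S) := by
    rw [conjDiagonalMeasure, FunLike.coe_sum, Finset.sum_apply]
    refine Finset.sum_congr rfl fun i _ => ?_
    rw [VectorMeasure.mapRange_apply, Measure.toSignedMeasure_apply_measurable hS]
  rw [h1]
  ext j k
  rw [Matrix.sum_apply, Matrix.mul_apply]
  refine Finset.sum_congr rfl fun i _ => ?_
  rw [conjSingleHom_apply_apply, Matrix.mul_diagonal, Matrix.conjTranspose_apply]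
  ring

theorem entryMeasure_conjDiagonalMeasure (j k : Fin m) :
    entryMeasure (conjDiagonalMeasure U ν) j k =
      ∑ i, scaledMeasure (ν i) (U j i * star (U k i)) := by
  ext S hS
  rw [entryMeasure_apply, conjDiagonalMeasure_apply U hS, FunLike.coe_sum,
    Finset.sum_apply, Matrix.mul_apply]
  refine Finset.sum_congr rfl fun i _ => ?_
  rw [scaledMeasure_apply _ hS, Matrix.mul_diagonal, Matrix.conjTranspose_apply]
  ring

theorem isMatrixStieltjesTransform_conjDiagonalMeasure (h0 : ∀ i, ν i (Set.Iio 0) = 0)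
    {F : ℂ → Matrix (Fin m) (Fin m) ℂ}
    (hF : ∀ z : ℂ, 0 < z.im → F z =
      U * Matrix.diagonal (fun i => ∫ x : ℝ, ((x : ℂ) - z)⁻¹ ∂ν i) * U.conjTranspose) :
    IsMatrixStieltjesTransform (Set.Ici 0) (conjDiagonalMeasure U ν) F := by
  refine ⟨fun S hS => ?_, ?_, fun z hz j k => ?_⟩
  · rw [conjDiagonalMeasure_apply U hS]
    refine Matrix.PosSemidef.mul_mul_conjTranspose_same (Matrix.posSemidef_diagonal_iff.2 fun i => ?_) U
    exact_mod_cast measureReal_nonneg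
  · rw [conjDiagonalMeasure_apply U measurableSet_Ici.compl, Set.compl_Ici]
    simp [Measure.real, h0]
  · rw [hF z hz, entryMeasure_conjDiagonalMeasure,
      VectorMeasure.integral_finsetSum_vectorMeasure fun i _ =>
        integrable_scaledMeasure _ (integrable_inv_ofReal_sub hz (ν i)), Matrix.mul_apply]
    refine Finset.sum_congr rfl fun i _ => ?_
    rw [integral_scaledMeasure _ (integrable_inv_ofReal_sub hz (ν i)), Matrix.mul_diagonal,
      Matrix.conjTranspose_apply]
    ring

end

/-! ### Diagonalization and reduction of the matrix equation. -/

section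

variable {m : ℕ}

theorem conj_diagonal_mul_conj_diagonal {U : Matrix (Fin m) (Fin m) ℂ}
    (hU : U.conjTranspose * U = 1) (d e : Fin m → ℂ) :
    (U * Matrix.diagonal d * U.conjTranspose) * (U * Matrix.diagonal e * U.conjTranspose) =
      U * Matrix.diagonal (fun i => d i * e i) * U.conjTranspose := by
  rw [← Matrix.diagonal_mul_diagonal]
  calc _ = U * Matrix.diagonal d * (U.conjTranspose * U) * Matrix.diagonal e * U.conjTranspose := by
        simp only [mul_assoc]
    _ = _ := by rw [hU, mul_one]; simp only [mul_assoc]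

theorem trace_conj_diagonal {U : Matrix (Fin m) (Fin m) ℂ} (hU : U.conjTranspose * U = 1)
    (d : Fin m → ℂ) : (U * Matrix.diagonal d * U.conjTranspose).trace = ∑ i, d i := by
  rw [Matrix.trace_mul_comm, ← mul_assoc, hU, one_mul, Matrix.trace_diagonal]

/-- Unitary diagonalization, with bounds on the eigenvalues. -/
theorem exists_diagonalization {R : Matrix (Fin m) (Fin m) ℂ} {a b : ℝ}
    (ha : (R - (a : ℂ) • (1 : Matrix (Fin m) (Fin m) ℂ)).PosSemidef)
    (hb : ((b : ℂ) • (1 : Matrix (Fin m) (Fin m) ℂ) - R).PosSemidef) :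
    ∃ (U : Matrix (Fin m) (Fin m) ℂ) (l : Fin m → ℝ), U * U.conjTranspose = 1 ∧
      U.conjTranspose * U = 1 ∧ R = U * Matrix.diagonal (fun i => (l i : ℂ)) * U.conjTranspose ∧
      (∀ i, a ≤ l i) ∧ ∀ i, l i ≤ b := by
  have hR : R.IsHermitian := by
    have h1 : ((a : ℂ) • (1 : Matrix (Fin m) (Fin m) ℂ)).IsHermitian := by
      rw [Matrix.IsHermitian, Matrix.conjTranspose_smul, Matrix.conjTranspose_one]
      simp
    have := ha.isHermitian.add h1
    rwa [sub_add_cancel] at this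
  obtain ⟨U, l, h1, h2, h3⟩ : ∃ (U : Matrix (Fin m) (Fin m) ℂ) (l : Fin m → ℝ),
      U * U.conjTranspose = 1 ∧ U.conjTranspose * U = 1 ∧
      R = U * Matrix.diagonal (fun i => (l i : ℂ)) * U.conjTranspose := by
    refine ⟨hR.eigenvectorUnitary, hR.eigenvalues, Unitary.coe_mul_star_self _,
      Unitary.coe_star_mul_self _, ?_⟩
    have := hR.spectral_theorem
    rw [Unitary.conjStarAlgAut_apply] at this
    exact this
  have h4 : U.conjTranspose * R * U = Matrix.diagonal (fun i => (l i : ℂ)) := by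
    rw [h3]
    calc _ = (U.conjTranspose * U) * Matrix.diagonal (fun i => (l i : ℂ)) *
          (U.conjTranspose * U) := by simp only [mul_assoc]
      _ = _ := by rw [h2, one_mul, mul_one]
  refine ⟨U, l, h1, h2, h3, fun i => ?_, fun i => ?_⟩
  · have h5 := ha.conjTranspose_mul_mul_same U
    have e : U.conjTranspose * (R - (a : ℂ) • (1 : Matrix (Fin m) (Fin m) ℂ)) * U =
        Matrix.diagonal (fun i => ((l i - a : ℝ) : ℂ)) := by
      rw [mul_sub, sub_mul, h4, mul_smul_comm, mul_one, smul_mul_assoc, h2,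
        Matrix.smul_one_eq_diagonal, Matrix.diagonal_sub]
      simp
    rw [e, Matrix.posSemidef_diagonal_iff] at h5
    have := h5 i
    rw [Complex.zero_le_real] at this
    linarith
  · have h5 := hb.conjTranspose_mul_mul_same U
    have e : U.conjTranspose * ((b : ℂ) • (1 : Matrix (Fin m) (Fin m) ℂ) - R) * U =
        Matrix.diagonal (fun i => ((b - l i : ℝ) : ℂ)) := by
      rw [mul_sub, sub_mul, h4, mul_smul_comm, mul_one, smul_mul_assoc, h2,
        Matrix.smul_one_eq_diagonal, Matrix.diagonal_sub]
      simp
    rw [e, Matrix.posSemidef_diagonal_iff] at h5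
    have := h5 i
    rw [Complex.zero_le_real] at this
    linarith

theorem couplingCoeff_sq (c : ℝ) (u t : ℂ) :
    couplingCoeff c (u ^ 2) t = u * selfEnergy c (u * t) := by
  have : 1 - u ^ 2 * (c : ℂ) ^ 2 * t ^ 2 = 1 - (c : ℂ) ^ 2 * (u * t) ^ 2 := by ring
  rw [couplingCoeff, selfEnergy, this]
  ring

/-- Take imaginary parts in `u² t + ‖u‖² t = 2 (Re u) u t`; this is where the root in the first
quadrant is used. -/
theorem im_mul_pos_of_im_pos {u t : ℂ} (hre : 0 < u.re) (ht : 0 < t.im)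
    (hzt : 0 < (u ^ 2 * t).im) : 0 < (u * t).im := by
  have hu : 0 < Complex.normSq u := by
    rw [Complex.normSq_apply]
    nlinarith [mul_self_nonneg u.im]
  have e : (u ^ 2 * t).im + Complex.normSq u * t.im = 2 * u.re * (u * t).im := by
    simp only [pow_two, Complex.mul_im, Complex.mul_re, Complex.normSq_apply]
    ring
  have h1 : 0 < 2 * u.re * (u * t).im := by
    rw [← e]
    have := mul_pos hu ht
    linarith
  exact pos_of_mul_pos_right h1 (by linarith)

section

variable {U : Matrix (Fin m) (Fin m) ℂ} {l : Fin m → ℝ} {c : ℝ} {u t : ℂ}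

theorem pencil_ne_zero (hl : ∀ i, 0 < l i) (hc : 0 < c) (hu : 0 < u.im) (hh : 0 < (u * t).im)
    (i : Fin m) : u ^ 2 + couplingCoeff c (u ^ 2) t * l i ≠ 0 := by
  have hu0 : u ≠ 0 := by rintro rfl; simp at hu
  have e : u ^ 2 + couplingCoeff c (u ^ 2) t * l i = u * (u + l i * selfEnergy c (u * t)) := by
    rw [couplingCoeff_sq]; ring
  rw [e]
  exact mul_ne_zero hu0 (add_mul_ne_zero_of_im (hl i).le hu (selfEnergy_im_pos hc hh).le)

theorem pencil_mul_eq_one (hU : U * U.conjTranspose = 1) (hU' : U.conjTranspose * U = 1)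
    (hl : ∀ i, 0 < l i) (hc : 0 < c) (hu : 0 < u.im) (hh : 0 < (u * t).im) :
    (u ^ 2 • (1 : Matrix (Fin m) (Fin m) ℂ) + couplingCoeff c (u ^ 2) t •
      (U * Matrix.diagonal (fun i => (l i : ℂ)) * U.conjTranspose)) *
      (U * Matrix.diagonal (fun i => (u ^ 2 + couplingCoeff c (u ^ 2) t * l i)⁻¹) *
        U.conjTranspose) = 1 := by
  have e : u ^ 2 • (1 : Matrix (Fin m) (Fin m) ℂ) + couplingCoeff c (u ^ 2) t •
      (U * Matrix.diagonal (fun i => (l i : ℂ)) * U.conjTranspose) =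
      U * Matrix.diagonal (fun i => u ^ 2 + couplingCoeff c (u ^ 2) t * l i) *
        U.conjTranspose := by
    have : Matrix.diagonal (fun i => u ^ 2 + couplingCoeff c (u ^ 2) t * l i) =
        u ^ 2 • (1 : Matrix (Fin m) (Fin m) ℂ) +
          couplingCoeff c (u ^ 2) t • Matrix.diagonal (fun i => (l i : ℂ)) := by
      rw [Matrix.smul_one_eq_diagonal, ← Matrix.diagonal_smul, Matrix.diagonal_add]
      rfl
    rw [this, mul_add, add_mul, mul_smul_comm, mul_smul_comm, smul_mul_assoc, smul_mul_assoc,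
      mul_one, hU]
  rw [e, conj_diagonal_mul_conj_diagonal hU']
  have : (fun i => (u ^ 2 + couplingCoeff c (u ^ 2) t * l i) *
      (u ^ 2 + couplingCoeff c (u ^ 2) t * l i)⁻¹) = fun _ => 1 := by
    funext i
    exact mul_inv_cancel₀ (pencil_ne_zero hl hc hu hh i)
  rw [this, Matrix.diagonal_one, mul_one, hU]

theorem neg_pencil_inv (l : Fin m → ℝ) (c : ℝ) (u t : ℂ) (i : Fin m) :
    -(u ^ 2 + couplingCoeff c (u ^ 2) t * l i)⁻¹ = u⁻¹ * dressedResolvent c (l i) u (u * t) := by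
  have e : u ^ 2 + couplingCoeff c (u ^ 2) t * l i = u * (u + l i * selfEnergy c (u * t)) := by
    rw [couplingCoeff_sq]; ring
  rw [e, dressedResolvent, mul_inv]
  ring

theorem canonicalT_eq (hU : U * U.conjTranspose = 1) (hU' : U.conjTranspose * U = 1)
    (hl : ∀ i, 0 < l i) (hc : 0 < c) (hu : 0 < u.im) (hh : 0 < (u * t).im) :
    canonicalT c (U * Matrix.diagonal (fun i => (l i : ℂ)) * U.conjTranspose) (u ^ 2) t =
      U * Matrix.diagonal (fun i => u⁻¹ * dressedResolvent c (l i) u (u * t)) *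
        U.conjTranspose := by
  rw [canonicalT, Matrix.inv_eq_right_inv (pencil_mul_eq_one hU hU' hl hc hu hh)]
  simp_rw [← neg_pencil_inv]
  rw [← neg_mul, ← mul_neg, Matrix.diagonal_neg]

theorem trace_equation_eq (hU : U * U.conjTranspose = 1) (hU' : U.conjTranspose * U = 1)
    (hl : ∀ i, 0 < l i) (hc : 0 < c) (hu : 0 < u.im) (hh : 0 < (u * t).im)
    {R : Matrix (Fin m) (Fin m) ℂ}
    (hR : R = U * Matrix.diagonal (fun i => (l i : ℂ)) * U.conjTranspose) :
    (1 / (m : ℂ)) * (R * (-(u ^ 2 • (1 : Matrix (Fin m) (Fin m) ℂ)) -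
        couplingCoeff c (u ^ 2) t • R)⁻¹).trace =
      u⁻¹ * resolventMap (fun i => l i / m) l c u (u * t) := by
  have e : (-(u ^ 2 • (1 : Matrix (Fin m) (Fin m) ℂ)) - couplingCoeff c (u ^ 2) t • R)⁻¹ =
      canonicalT c R (u ^ 2) t := by
    have h1 := pencil_mul_eq_one hU hU' hl hc hu hh
    rw [← hR] at h1
    rw [canonicalT, Matrix.inv_eq_right_inv h1]
    refine Matrix.inv_eq_right_inv ?_
    rw [← neg_add', neg_mul_neg, h1]
  rw [e, hR, canonicalT_eq hU hU' hl hc hu hh, conj_diagonal_mul_conj_diagonal hU',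
    trace_conj_diagonal hU', resolventMap, Finset.mul_sum, Finset.mul_sum]
  refine Finset.sum_congr rfl fun i _ => ?_
  push_cast
  ring

/-- The conditions on `t` and `u² t` stay on the right: for a fixed point they are later supplied by
the integral representation. -/
theorem isCanonicalSolution_iff (hU : U * U.conjTranspose = 1) (hU' : U.conjTranspose * U = 1)
    (hl : ∀ i, 0 < l i) (hc : 0 < c) (hre : 0 < u.re) (hu : 0 < u.im)
    {R : Matrix (Fin m) (Fin m) ℂ}
    (hR : R = U * Matrix.diagonal (fun i => (l i : ℂ)) * U.conjTranspose) :
    IsCanonicalSolution c R (u ^ 2) t ↔ 0 < t.im ∧ 0 < (u ^ 2 * t).im ∧ 0 < (u * t).im ∧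
      resolventMap (fun i => l i / m) l c u (u * t) = u * t := by
  have hu0 : u ≠ 0 := by rintro rfl; simp at hu
  constructor
  · rintro ⟨h1, h2, h3⟩
    have h4 := im_mul_pos_of_im_pos hre h2 h3
    rw [trace_equation_eq hU hU' hl hc hu h4 hR] at h1
    refine ⟨h2, h3, h4, ?_⟩
    conv_rhs => rw [h1, mul_inv_cancel_left₀ hu0]
  · rintro ⟨h2, h3, h4, h5⟩
    refine ⟨?_, h2, h3⟩
    rw [trace_equation_eq hU hU' hl hc hu h4 hR, h5, inv_mul_cancel_left₀ hu0]

end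

/-! ### Assembly for one matrix, then uniformity in `N`. -/

/-- The sum `∑ wᵢ νᵢ` of positive measures. -/
noncomputable def weightedMeasure (w : Fin m → ℝ) (ν : Fin m → Measure ℝ) : Measure ℝ :=
  ∑ i, ENNReal.ofReal (w i) • ν i

section

variable {w : Fin m → ℝ} {ν : Fin m → Measure ℝ}

instance isFiniteMeasure_weightedMeasure [∀ i, IsProbabilityMeasure (ν i)] :
    IsFiniteMeasure (weightedMeasure w ν) := by
  refine ⟨?_⟩
  simp only [weightedMeasure, Measure.coe_finsetSum, Finset.sum_apply, Measure.smul_apply,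
    measure_univ, smul_eq_mul, mul_one]
  exact ENNReal.sum_lt_top.2 fun i _ => ENNReal.ofReal_lt_top

theorem weightedMeasure_real [∀ i, IsProbabilityMeasure (ν i)] (hw : ∀ i, 0 ≤ w i) (S : Set ℝ) :
    (weightedMeasure w ν).real S = ∑ i, w i * (ν i).real S := by
  simp only [weightedMeasure, Measure.real, Measure.coe_finsetSum, Finset.sum_apply,
    Measure.smul_apply, smul_eq_mul]
  rw [ENNReal.toReal_sum fun i _ => ENNReal.mul_ne_top ENNReal.ofReal_ne_top (measure_ne_top _ _)]
  exact Finset.sum_congr rfl fun i _ => by rw [ENNReal.toReal_mul, ENNReal.toReal_ofReal (hw i)]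

theorem integrable_weightedMeasure {E : Type*} [NormedAddCommGroup E] {f : ℝ → E}
    (hf : ∀ i, Integrable f (ν i)) : Integrable f (weightedMeasure w ν) :=
  integrable_finsetSum_measure.2 fun i _ => (hf i).smul_measure ENNReal.ofReal_ne_top

theorem integral_weightedMeasure {E : Type*} [NormedAddCommGroup E] [NormedSpace ℝ E]
    (hw : ∀ i, 0 ≤ w i) {f : ℝ → E} (hf : ∀ i, Integrable f (ν i)) :
    ∫ x, f x ∂weightedMeasure w ν = ∑ i, w i • ∫ x, f x ∂ν i := by
  rw [weightedMeasure, integral_finsetSum_measure fun i _ =>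
    (hf i).smul_measure ENNReal.ofReal_ne_top]
  exact Finset.sum_congr rfl fun i _ => by rw [integral_smul_measure, ENNReal.toReal_ofReal (hw i)]

end

/-- The whole result for one matrix. In the last bound `c` and `b` enter only through `K`, so a
common `K` gives uniformity. -/
theorem canonicalSolution_properties (hm : 1 ≤ m) {c : ℝ} (hc : 0 < c)
    {R : Matrix (Fin m) (Fin m) ℂ} {a b : ℝ} (ha : 0 < a)
    (hRa : (R - (a : ℂ) • (1 : Matrix (Fin m) (Fin m) ℂ)).PosSemidef)
    (hRb : ((b : ℂ) • (1 : Matrix (Fin m) (Fin m) ℂ) - R).PosSemidef)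
    {K : ℝ} (hK1 : 1 ≤ K) (hK : 2 * (c * b * b) ≤ K) :
    (∀ z : ℂ, 0 < z.im → ∃! s : ℂ, IsCanonicalSolution c R z s) ∧
    ∀ t : ℂ → ℂ, (∀ z : ℂ, 0 < z.im → IsCanonicalSolution c R z (t z)) →
      (∀ z : ℂ, 0 < z.im → 1 - z * (c : ℂ) ^ 2 * t z ^ 2 ≠ 0 ∧
        IsUnit (z • (1 : Matrix (Fin m) (Fin m) ℂ) + couplingCoeff c z (t z) • R)) ∧
      (∃ (μ : Measure ℝ) (ν : VectorMeasure ℝ (Matrix (Fin m) (Fin m) ℂ)),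
        IsStieltjesTransform (Set.Ici 0) μ t ∧
        ((μ.real (Set.Ici 0) : ℝ) : ℂ) = (1 / (m : ℂ)) * R.trace ∧
        Integrable (fun x : ℝ => x) μ ∧
        ((∫ x in Set.Ici (0 : ℝ), x ∂μ : ℝ) : ℂ) =
          (c : ℂ) * ((1 / (m : ℂ)) * R.trace) * ((1 / (m : ℂ)) * (R ^ 2).trace) ∧
        IsMatrixStieltjesTransform (Set.Ici 0) ν (fun z => canonicalT c R z (t z)) ∧
        ν (Set.Ici 0) = 1 ∧
        ∀ S : Set ℝ, MeasurableSet S →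
          ((μ.real S : ℝ) : ℂ) = (1 / (m : ℂ)) * (R * ν S).trace) ∧
      ∀ z : ℂ, 0 < z.im → 1 / ‖1 - z * ((c : ℂ) * t z) ^ 2‖ ≤
        8 * (K ^ 2 + ‖z‖ ^ 2) ^ 2 / z.im ^ 3 := by
  obtain ⟨U, l, hU, hU', hR, hla, hlb⟩ := exists_diagonalization hRa hRb
  have hmpos : (0 : ℝ) < m := by exact_mod_cast hm
  have hl : ∀ i, 0 < l i := fun i => ha.trans_le (hla i)
  have : Nonempty (Fin m) := ⟨⟨0, hm⟩⟩
  set w : Fin m → ℝ := fun i => l i / m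
  have hw : ∀ i, 0 < w i := fun i => div_pos (hl i) hmpos
  have hτ : 0 < ∑ i, w i := sum_pos_of_pos hw
  have hτb : ∑ i, w i ≤ b := by
    calc ∑ i, w i ≤ ∑ _i : Fin m, b / m := Finset.sum_le_sum fun i _ => by
          simp only [w]; have := hlb i; gcongr
      _ = b := by simp; field_simp
  have hb : 0 < b := hτ.trans_le hτb
  obtain ⟨ν, hν, hν0, hνi, hνm, hνh⟩ := exists_measures_of_resolventMap hw hl hc
  have hνK : ∀ i, 2 * ∫ x, x ∂ν i ≤ K := fun i => by
    rw [hνm]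
    refine le_trans ?_ hK
    have := hlb i
    have := (hl i).le
    gcongr
  -- The Stieltjes transform candidate and its positivity.
  have hT : ∀ z : ℂ, 0 < z.im → ∑ i, w i * (z.im / (4 * (K ^ 2 + ‖z‖ ^ 2))) ≤
      (∑ i, (w i : ℂ) * ∫ x : ℝ, ((x : ℂ) - z)⁻¹ ∂ν i).im := fun z hz => by
    rw [Complex.im_sum]
    refine Finset.sum_le_sum fun i _ => ?_
    rw [Complex.im_ofReal_mul]
    exact mul_le_mul_of_nonneg_left (le_im_integral_inv (hν0 i) (hνi i) (by linarith) (hνK i) hz)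
      (hw i).le
  have hzT : ∀ z : ℂ, 0 < z.im →
      0 < (z * ∑ i, (w i : ℂ) * ∫ x : ℝ, ((x : ℂ) - z)⁻¹ ∂ν i).im := fun z hz => by
    rw [Finset.mul_sum, Complex.im_sum]
    refine Finset.sum_pos (fun i _ => ?_) Finset.univ_nonempty
    rw [mul_left_comm, Complex.im_ofReal_mul]
    refine mul_pos (hw i) (im_mul_integral_pos (hν0 i) (hνi i) ?_ hz)
    rw [hνm]
    have := hl i
    positivity
  have hne : ∀ u : ℂ, 0 < u.im → u ≠ 0 := fun u hu h => by simp [h] at hu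
  have hsum : ∀ u h : ℂ, resolventMap w l c u h = h →
      (∀ i, dressedResolvent c (l i) u h = u * ∫ x : ℝ, ((x : ℂ) - u ^ 2)⁻¹ ∂ν i) →
      h = u * ∑ i, (w i : ℂ) * ∫ x : ℝ, ((x : ℂ) - u ^ 2)⁻¹ ∂ν i := fun u h hfix hG => by
    conv_lhs => rw [← hfix]
    rw [resolventMap, Finset.mul_sum]
    exact Finset.sum_congr rfl fun i _ => by rw [hG]; ring
  have hiff : ∀ u t : ℂ, 0 < u.re → 0 < u.im → (IsCanonicalSolution c R (u ^ 2) t ↔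
      0 < t.im ∧ 0 < (u ^ 2 * t).im ∧ 0 < (u * t).im ∧ resolventMap w l c u (u * t) = u * t) :=
    fun u t h1 h2 => isCanonicalSolution_iff hU hU' hl hc h1 h2 hR
  -- Every canonical solution is given by these measures.
  have hsol : ∀ u t : ℂ, 0 < u.re → 0 < u.im → 0 < (u ^ 2).im → IsCanonicalSolution c R (u ^ 2) t →
      (∀ i, u⁻¹ * dressedResolvent c (l i) u (u * t) = ∫ x : ℝ, ((x : ℂ) - u ^ 2)⁻¹ ∂ν i) ∧
      t = ∑ i, (w i : ℂ) * ∫ x : ℝ, ((x : ℂ) - u ^ 2)⁻¹ ∂ν i := fun u t h1 h2 h3 ht => by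
    obtain ⟨-, -, ht1, ht2⟩ := (hiff u t h1 h2).1 ht
    obtain ⟨h, hh, hfix, hG⟩ := hνh u h2 h3
    have e := resolventMap_fixed_unique hw hl hc h2 ht1 hh ht2 hfix
    rw [e]
    refine ⟨fun i => by rw [hG, inv_mul_cancel_left₀ (hne u h2)], ?_⟩
    exact mul_left_cancel₀ (hne u h2) (e.trans (hsum u h hfix hG))
  refine ⟨fun z hz => ?_, fun t ht => ⟨fun z hz => ?_, ?_, fun z hz => ?_⟩⟩
  · obtain ⟨u, h1, h2, rfl⟩ := exists_sq_eq_of_im_pos hz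
    refine ⟨∑ i, (w i : ℂ) * ∫ x : ℝ, ((x : ℂ) - u ^ 2)⁻¹ ∂ν i, ?_,
      fun s hs => (hsol u s h1 h2 hz hs).2⟩
    obtain ⟨h, hh, hfix, hG⟩ := hνh u h2 hz
    have e := hsum u h hfix hG
    rw [hiff u _ h1 h2, ← e]
    refine ⟨lt_of_lt_of_le (Finset.sum_pos (fun i _ => ?_) Finset.univ_nonempty) (hT _ hz),
      hzT _ hz, hh, hfix⟩
    have := hw i
    positivity
  · obtain ⟨u, h1, h2, rfl⟩ := exists_sq_eq_of_im_pos hz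
    obtain ⟨-, -, h3, -⟩ := (hiff u _ h1 h2).1 (ht _ hz)
    refine ⟨?_, ?_⟩
    · have e : 1 - u ^ 2 * (c : ℂ) ^ 2 * t (u ^ 2) ^ 2 = 1 - (c : ℂ) ^ 2 * (u * t (u ^ 2)) ^ 2 := by
        ring
      rw [e]
      exact one_sub_sq_ne_zero hc h3
    · have := pencil_mul_eq_one hU hU' hl hc h2 h3
      rw [← hR] at this
      exact IsUnit.of_mul_eq_one _ this
  · have htr : (1 / (m : ℂ)) * R.trace = ((∑ i, w i : ℝ) : ℂ) := by
      rw [hR, trace_conj_diagonal hU', Finset.mul_sum]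
      push_cast
      exact Finset.sum_congr rfl fun i _ => by simp only [w]; push_cast; ring
    have htr2 : (1 / (m : ℂ)) * (R ^ 2).trace = ((∑ i, w i * l i : ℝ) : ℂ) := by
      rw [pow_two, hR, conj_diagonal_mul_conj_diagonal hU', trace_conj_diagonal hU',
        Finset.mul_sum]
      push_cast
      exact Finset.sum_congr rfl fun i _ => by simp only [w]; push_cast; ring
    have huniv : ∀ i, (ν i).real (Set.Ici 0) = 1 := fun i => by
      rw [← Set.compl_Iio, probReal_compl_eq_one_sub measurableSet_Iio, Measure.real, hν0]
      simp
    have hμ0 : weightedMeasure w ν (Set.Ici 0)ᶜ = 0 := by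
      simp [weightedMeasure, Set.compl_Ici, hν0]
    refine ⟨weightedMeasure w ν, conjDiagonalMeasure U ν, ⟨inferInstance, hμ0, fun z hz => ?_⟩,
      ?_, integrable_weightedMeasure hνi, ?_,
      isMatrixStieltjesTransform_conjDiagonalMeasure U hν0 fun z hz => ?_, ?_, fun S hS => ?_⟩
    · obtain ⟨u, h1, h2, rfl⟩ := exists_sq_eq_of_im_pos hz
      rw [integral_weightedMeasure (fun i => (hw i).le) fun i => integrable_inv_ofReal_sub hz _]
      exact (hsol u _ h1 h2 hz (ht _ hz)).2
    · rw [weightedMeasure_real fun i => (hw i).le, htr]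
      simp [huniv]
    · rw [Measure.restrict_eq_self_of_ae_mem
        (mem_ae_iff.2 hμ0 : ∀ᵐ x ∂weightedMeasure w ν, x ∈ Set.Ici (0 : ℝ)),
        integral_weightedMeasure (fun i => (hw i).le) hνi, htr, htr2]
      norm_cast
      rw [Finset.mul_sum]
      exact Finset.sum_congr rfl fun i _ => by rw [hνm, smul_eq_mul]; ring
    · obtain ⟨u, h1, h2, rfl⟩ := exists_sq_eq_of_im_pos hz
      obtain ⟨-, -, h3, -⟩ := (hiff u _ h1 h2).1 (ht _ hz)
      simp_rw [← (hsol u _ h1 h2 hz (ht _ hz)).1]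
      rw [hR]
      exact canonicalT_eq hU hU' hl hc h2 h3
    · rw [conjDiagonalMeasure_apply U measurableSet_Ici]
      simp [huniv, hU]
    · rw [conjDiagonalMeasure_apply U hS, hR, conj_diagonal_mul_conj_diagonal hU',
        trace_conj_diagonal hU', weightedMeasure_real fun i => (hw i).le, Finset.mul_sum]
      push_cast
      exact Finset.sum_congr rfl fun i _ => by simp only [w]; push_cast; ring
  · obtain ⟨u, h1, h2, rfl⟩ := exists_sq_eq_of_im_pos hz
    obtain ⟨-, -, h3, hfix⟩ := (hiff u _ h1 h2).1 (ht _ hz)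
    have hlow := hT _ hz
    rw [← (hsol u _ h1 h2 hz (ht _ hz)).2, ← Finset.sum_mul] at hlow
    set z := u ^ 2 with hzu
    have e : 1 - z * ((c : ℂ) * t z) ^ 2 = 1 - (c : ℂ) ^ 2 * (u * t z) ^ 2 := by
      rw [hzu]; ring
    rw [e]
    set X := ‖1 - (c : ℂ) ^ 2 * (u * t z) ^ 2‖
    have hX : 0 < X := norm_pos_iff.2 (one_sub_sq_ne_zero hc h3)
    have hS := norm_sq_resolventMap_le hw hl hc h2 h3.le
    rw [hfix] at hS
    have b1 := im_mul_norm_le hτ hc h3 hS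
    rw [norm_mul] at b1
    have hzim : z.im = 2 * (u.re * u.im) := by rw [hzu, pow_two, Complex.mul_im]; ring
    -- This uses `Im z = 2 Re u Im u ≤ 2 ‖u‖ Im u`.
    have b2 : z.im * ‖t z‖ ≤ 2 * ((∑ i, w i) * X) := by
      have := mul_le_mul_of_nonneg_left (Complex.re_le_norm u)
        (mul_nonneg h2.le (norm_nonneg (t z)))
      rw [hzim]
      linarith
    set D := K ^ 2 + ‖z‖ ^ 2
    have hD : 0 < D := by positivity
    have b3 : (∑ i, w i) * (z.im / (4 * D)) ≤ ‖t z‖ := hlow.trans (Complex.im_le_norm _)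
    -- The total mass `∑ wᵢ` cancels between the upper and lower bounds on `‖t z‖`.
    have b4 : z.im ^ 2 ≤ 8 * D * X := by
      have b5 := (mul_le_mul_of_nonneg_left b3 hz.le).trans b2
      have b6 : z.im * (z.im / (4 * D)) ≤ 2 * X := by
        refine le_of_mul_le_mul_left ?_ hτ
        linarith
      rw [← mul_div_assoc, div_le_iff₀ (by positivity)] at b6
      linarith
    -- Here `K ≥ 1` enters: `Im z ≤ 1 + ‖z‖² ≤ D` exchanges one power of `Im z` for one of `D`.
    have b7 : z.im ≤ D := by
      have := Complex.im_le_norm z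
      simp only [D]
      nlinarith [sq_nonneg (‖z‖ - 1)]
    rw [div_le_div_iff₀ hX (by positivity)]
    calc 1 * z.im ^ 3 = z.im ^ 2 * z.im := by ring
      _ ≤ (8 * D * X) * D := by gcongr
      _ = _ := by ring

end

theorem mainTheorem5
    (L : ℕ) (M : ℕ → ℕ) (hM : ∀ N : ℕ, 1 ≤ N → 1 ≤ M N)
    (cstar : ℝ) (hcstar : 0 < cstar)
    (hc : Tendsto (dimRatio L M) atTop (𝓝 cstar))
    (a b : ℝ) (ha : 0 < a) (hb : 0 < b)
    (R : (N : ℕ) → Matrix (Fin (M N)) (Fin (M N)) ℂ)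
    (hRa : ∀ N : ℕ, 1 ≤ N →
      (R N - (a : ℂ) • (1 : Matrix (Fin (M N)) (Fin (M N)) ℂ)).PosSemidef)
    (hRb : ∀ N : ℕ, 1 ≤ N →
      ((b : ℂ) • (1 : Matrix (Fin (M N)) (Fin (M N)) ℂ) - R N).PosDef) :
    (∀ N : ℕ, 1 ≤ N → ∀ z : ℂ, 0 < z.im →
      ∃! s : ℂ, IsCanonicalSolution (dimRatio L M N) (R N) z s) ∧
    ∀ t : ℕ → ℂ → ℂ,
      (∀ N : ℕ, 1 ≤ N → ∀ z : ℂ, 0 < z.im →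
        IsCanonicalSolution (dimRatio L M N) (R N) z (t N z)) →
      -- neither the quotient nor the inverse in the equation is degenerate
      (∀ N : ℕ, 1 ≤ N → ∀ z : ℂ, 0 < z.im →
        1 - z * (dimRatio L M N : ℂ) ^ 2 * t N z ^ 2 ≠ 0 ∧
        IsUnit (z • (1 : Matrix (Fin (M N)) (Fin (M N)) ℂ) +
          couplingCoeff (dimRatio L M N) z (t N z) • R N)) ∧
      -- the measures associated with `t_N` and `T_N`
      (∀ N : ℕ, 1 ≤ N →
        ∃ (μ : Measure ℝ) (ν : VectorMeasure ℝ (Matrix (Fin (M N)) (Fin (M N)) ℂ)),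
          IsStieltjesTransform (Set.Ici 0) μ (t N) ∧
          ((μ.real (Set.Ici 0) : ℝ) : ℂ) = (1 / (M N : ℂ)) * (R N).trace ∧
          Integrable (fun x : ℝ => x) μ ∧
          ((∫ x in Set.Ici (0 : ℝ), x ∂μ : ℝ) : ℂ) =
            (dimRatio L M N : ℂ) * ((1 / (M N : ℂ)) * (R N).trace) *
              ((1 / (M N : ℂ)) * (R N ^ 2).trace) ∧
          IsMatrixStieltjesTransform (Set.Ici 0) ν
            (fun z => canonicalT (dimRatio L M N) (R N) z (t N z)) ∧
          ν (Set.Ici 0) = 1 ∧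
          ∀ S : Set ℝ, MeasurableSet S →
            ((μ.real S : ℝ) : ℂ) = (1 / (M N : ℂ)) * (R N * ν S).trace) ∧
      -- the uniform lower bound on `|1 - z (c_N t_N(z))²|`
      (∃ β κ : ℝ, 0 < β ∧ 0 < κ ∧ ∀ N : ℕ, 1 ≤ N → ∀ z : ℂ, 0 < z.im →
        1 / ‖1 - z * ((dimRatio L M N : ℂ) * t N z) ^ 2‖ ≤
          κ * (β ^ 2 + ‖z‖ ^ 2) ^ 2 / z.im ^ 3) := by
  -- For `L = 0` all ratios vanish, against a positive limit.
  have hL : 0 < L := by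
    rcases Nat.eq_zero_or_pos L with rfl | h
    · have h0 : dimRatio 0 M = fun _ => 0 := by funext N; simp [dimRatio]
      rw [h0] at hc
      exact absurd (tendsto_nhds_unique hc tendsto_const_nhds) hcstar.ne'
    · exact h
  have hcN : ∀ N : ℕ, 1 ≤ N → 0 < dimRatio L M N := fun N hN => by
    have h1 : 0 < N := hN
    have h2 : 0 < M N := hM N hN
    unfold dimRatio
    positivity
  obtain ⟨C, hC⟩ := hc.bddAbove_range
  have hCN : ∀ N, dimRatio L M N ≤ C := fun N => hC ⟨N, rfl⟩
  have hC0 : 0 < C := (hcN 1 le_rfl).trans_le (hCN 1)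
  -- `C` bounds every `c_N`, so `2 c_N b² ≤ K` bounds twice all the means; the added `1` ensures `K
  -- ≥ 1`.
  set K := 2 * (C * b * b) + 1
  have hK1 : 1 ≤ K := by
    have : 0 < C * b * b := by positivity
    linarith
  have key := fun N hN => canonicalSolution_properties (hM N hN) (hcN N hN) ha (hRa N hN)
    (hRb N hN).posSemidef hK1 (by
      have := mul_le_mul_of_nonneg_right (mul_le_mul_of_nonneg_right (hCN N) hb.le) hb.le
      linarith)
  refine ⟨fun N hN => (key N hN).1, fun t ht => ⟨fun N hN => ((key N hN).2 _ (ht N hN)).1,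
    fun N hN => ((key N hN).2 _ (ht N hN)).2.1, K, 8, by linarith, by norm_num,
    fun N hN => ((key N hN).2 _ (ht N hN)).2.2⟩⟩
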